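/- Let $d\ge 2$, $r\ge 2$, $\mathcal X=\{1,\dots,r\}$, $V=\{1,\dots,d\}$, and let $P$ be a fixed probability distribution on $\mathcal X^d$ (not necessarily forest-structured) whose pairwise marginals $P_{i,j}$, $i\neq j$, are positive everywhere. All logarithms are natural. For a distribution $Q$ on $\mathcal X^d$ put $I(Q_{i,j})=\sum_{a,b}Q_{i,j}(a,b)\log\frac{Q_{i,j}(a,b)}{Q_i(a)Q_j(b)}$. Call $Q$ forest-structured if it is positive everywhere and there is an acyclic graph $G$ on $V$ on which it is Markov: $Q(x_i\mid x_{\mathrm{nbd}(i)})=Q(x_i\mid x_{V\setminus i})$ for all $i\in V$ and all $x$. Let $\widetilde P$ be a forest projection of $P$, i.e. a minimizer of the Kullback–Leibler divergence $D(P\,\|\,Q)$ over all forest-structured $Q$. Let $(\varepsilon_n)$ be a real sequence with $\varepsilon_n\to 0$. From $n\ge1$ samples $\mathbf x^n\in(\mathcal X^d)^n$ with empirical distribution $\widehat P$, the algorithm $\mathsf{CLThres}$ takes a spanning tree on $V$ maximizing $\sum_{(i,j)} I(\widehat P_{i,j})$, sorts its edges $\widehat e_1,\dots,\widehat e_{d-1}$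 so that $I(\widehat P_{\widehat e_1})\ge\dots\ge I(\widehat P_{\widehat e_{d-1}})$, and keeps the first $\widehat k_n\in\{0,\dots,d-1\}$ edges, where $I(\widehat P_{\widehat e_j})\ge\varepsilon_n$ for $j\le\widehat k_n$ and $I(\widehat P_{\widehat e_j})\le\varepsilon_n$ for $j>\widehat k_n$; all ties are broken arbitrarily. With $\widehat E$ the set of kept edges, its estimated distribution is $$P^*(\mathbf x)=\prod_{i\in V}\widehat P_i(x_i)\prod_{(i,j)\in\widehat E}\frac{\widehat P_{i,j}(x_i,x_j)}{\widehat P_i(x_i)\widehat P_j(x_j)},$$ with the convention that $P^*(\mathbf x)=0$ if some $\widehat P_i(x_i)=0$. Its risk is $\mathcal R_n(P^*)=D(P\,\|\,P^*)-D(P\,\|\,\widetilde P)\in[0,\infty]$, and $\mathcal C_{n,\delta}=\{\mathbf x^n:\mathcal R_n(P^*)/d>\delta\}$. Let $P^n$ be the $n$-fold product of $P$. **Theorem (error exponent for $\delta$-risk consistency).** There is a constant $\delta_0>0$, depending only on $P$, such that for every such sequence $(\varepsilon_n)$, every tie-breaking rule and all $0<\delta<\delta_0$, $$\limsup_{n\to\infty}\frac1n\log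 P^n(\mathcal C_{n,\delta})\le-\delta\qquad\text{and}\qquad\liminf_{n\to\infty}\frac1n\log P^n(\mathcal C_{n,\delta})\ge-\delta d,$$ where $\log 0=-\infty$. -/

import Mathlib

open MeasureTheory Filter

noncomputable section

namespace CLThres

/-- Node marginal `μ_i(a)` of a law `μ` on `𝒳^d`, where `𝒳 = Fin r`. -/
def nodeMarginal {d r : ℕ} (μ : Measure (Fin d → Fin r)) (i : Fin d) (a : Fin r) : ℝ :=
  μ.real {x | x i = a}

/-- Pairwise marginal `μ_{i,j}(a,b)`. -/
def pairMarginal {d r : ℕ} (μ : Measure (Fin d → Fin r)) (i j : Fin d) (a b : Fin r) : ℝ :=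
  μ.real {x | x i = a ∧ x j = b}

theorem pairMarginal_swap {d r : ℕ} (μ : Measure (Fin d → Fin r)) (i j : Fin d) (a b : Fin r) :
    pairMarginal μ i j a b = pairMarginal μ j i b a := by
  unfold pairMarginal
  congr 1
  ext x
  exact and_comm

/-- Mutual information `I(μ_{i,j})` in nats; the convention `0 log 0 = 0` is automatic. -/
def mutualInfo {d r : ℕ} (μ : Measure (Fin d → Fin r)) (i j : Fin d) : ℝ :=
  ∑ a : Fin r, ∑ b : Fin r, pairMarginal μ i j a b *
    Real.log (pairMarginal μ i j a b / (nodeMarginal μ i a * nodeMarginal μ j b))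

theorem mutualInfo_comm {d r : ℕ} (μ : Measure (Fin d → Fin r)) (i j : Fin d) :
    mutualInfo μ i j = mutualInfo μ j i := by
  unfold mutualInfo
  rw [Finset.sum_comm]
  refine Finset.sum_congr rfl fun b _ => Finset.sum_congr rfl fun a _ => ?_
  rw [pairMarginal_swap μ i j a b, mul_comm (nodeMarginal μ i a)]

/-- Mutual information as a function of an unordered pair of nodes. -/
def edgeInfo {d r : ℕ} (μ : Measure (Fin d → Fin r)) : Sym2 (Fin d) → ℝ :=
  Sym2.lift ⟨mutualInfo μ, mutualInfo_comm μ⟩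

/-- The factor `μ_{i,j}(x_i,x_j) / (μ_i(x_i) μ_j(x_j))` of an unordered pair of nodes. -/
def edgeFactor {d r : ℕ} (μ : Measure (Fin d → Fin r)) (x : Fin d → Fin r) :
    Sym2 (Fin d) → ℝ :=
  Sym2.lift ⟨fun i j => pairMarginal μ i j (x i) (x j) /
      (nodeMarginal μ i (x i) * nodeMarginal μ j (x j)), fun i j => by
    simp only [pairMarginal_swap μ i j, mul_comm (nodeMarginal μ i (x i))]⟩

/-- Local Markov property: `Q(x_i | x_{nbd(i)}) = Q(x_i | x_{V∖i})` for all `i` and `x`. It is only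
used for laws that charge every point, so that no conditioning event is null. -/
def IsMarkovOn {d r : ℕ} (Q : Measure (Fin d → Fin r)) (G : SimpleGraph (Fin d)) : Prop :=
  ∀ (i : Fin d) (x : Fin d → Fin r),
    ProbabilityTheory.cond Q {y | ∀ j, G.Adj i j → y j = x j} {y | y i = x i} =
      ProbabilityTheory.cond Q {y | ∀ j, j ≠ i → y j = x j} {y | y i = x i}

/-- Forest-structured distributions: the positive probability laws that are Markov on a forest. -/
def IsForestStructured {d r : ℕ} (Q : Measure (Fin d → Fin r)) : Prop :=
  IsProbabilityMeasure Q ∧ (∀ x, 0 < Q {x}) ∧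
    ∃ G : SimpleGraph (Fin d), G.IsAcyclic ∧ IsMarkovOn Q G

/-- `R` is a forest projection of `P`: a minimizer of `D(P ‖ Q)` over forest-structured `Q`. -/
def IsForestProjection {d r : ℕ} (P R : Measure (Fin d → Fin r)) : Prop :=
  IsForestStructured R ∧ ∀ Q : Measure (Fin d → Fin r), IsForestStructured Q →
    InformationTheory.klDiv P R ≤ InformationTheory.klDiv P Q

/-- The empirical distribution (type) of `n` samples. -/
def empirical {d r n : ℕ} (xs : Fin n → Fin d → Fin r) : Measure (Fin d → Fin r) :=
  (n : ENNReal)⁻¹ • ∑ l : Fin n, Measure.dirac (xs l)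

open Classical in
/-- Total mutual information of the edges of a graph. -/
def weight {d r : ℕ} (μ : Measure (Fin d → Fin r)) (G : SimpleGraph (Fin d)) : ℝ :=
  ∑ e ∈ G.edgeFinset, edgeInfo μ e

/-- `T` is a maximum-weight spanning tree for the mutual informations of `μ`. -/
def IsMaxWeightTree {d r : ℕ} (μ : Measure (Fin d → Fin r)) (T : SimpleGraph (Fin d)) : Prop :=
  T.IsTree ∧ ∀ T' : SimpleGraph (Fin d), T'.IsTree → weight μ T' ≤ weight μ T

/-- `F` is a forest that `CLThres` may return on the type `μ` with threshold `ε`: take a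
maximum-weight spanning tree, list its edges `e 0, …, e (d-2)` by decreasing mutual information, and
keep the first `k` of them, where the kept values are `≥ ε` and the discarded ones are `≤ ε`
(`k = 0` and `k = d - 1` are allowed). All ties may be broken arbitrarily. -/
def IsOutput {d r : ℕ} (ε : ℝ) (μ : Measure (Fin d → Fin r)) (F : SimpleGraph (Fin d)) : Prop :=
  ∃ T : SimpleGraph (Fin d), IsMaxWeightTree μ T ∧
    ∃ e : Fin (d - 1) → Sym2 (Fin d), Function.Injective e ∧ Set.range e = T.edgeSet ∧
      Antitone (fun j => edgeInfo μ (e j)) ∧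
      ∃ k : ℕ, k ≤ d - 1 ∧
        (∀ j : Fin (d - 1), (j : ℕ) < k → ε ≤ edgeInfo μ (e j)) ∧
        (∀ j : Fin (d - 1), k ≤ (j : ℕ) → edgeInfo μ (e j) ≤ ε) ∧
        F = SimpleGraph.fromEdgeSet (e '' {j | (j : ℕ) < k})

open Classical in
/-- The law with mass function `x ↦ ∏_i μ_i(x_i) ∏_{(i,j) ∈ F} μ_{i,j}(x_i,x_j)/(μ_i(x_i) μ_j(x_j))`,
the reverse I-projection of `μ` onto the forest `F`. With `μ` the type this is the estimate `P*`. -/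
def forestLaw {d r : ℕ} (μ : Measure (Fin d → Fin r)) (F : SimpleGraph (Fin d)) :
    Measure (Fin d → Fin r) :=
  ∑ x : Fin d → Fin r, ENNReal.ofReal
    ((∏ i : Fin d, nodeMarginal μ i (x i)) * ∏ e ∈ F.edgeFinset, edgeFactor μ x e) •
      Measure.dirac x

/-- The risk `D(P ‖ P*) - D(P ‖ P̃)`, possibly `+∞`, of an estimate `Pstar`. -/
def risk {d r : ℕ} (P Ptilde Pstar : Measure (Fin d → Fin r)) : EReal :=
  (InformationTheory.klDiv P Pstar : EReal) - (InformationTheory.klDiv P Ptilde : EReal)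

/-- The event `C_{n,δ}` that the average risk exceeds `δ`, for the estimated forest `Fhat`. -/
def riskEvent {d r : ℕ} (P Ptilde : Measure (Fin d → Fin r)) (n : ℕ)
    (Fhat : (Fin n → Fin d → Fin r) → SimpleGraph (Fin d)) (δ : ℝ) :
    Set (Fin n → Fin d → Fin r) :=
  {xs | (δ : EReal) < risk P Ptilde (forestLaw (empirical xs) (Fhat xs)) / (d : EReal)}

/-- `(1/n) log P^n(A)`, with `log 0 = -∞`. -/
def normalizedLogProb {d r : ℕ} (P : Measure (Fin d → Fin r)) (n : ℕ)
    (A : Set (Fin n → Fin d → Fin r)) : EReal :=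
  ENNReal.log (Measure.pi (fun _ : Fin n => P) A) / (n : EReal)

end CLThres

end

open MeasureTheory Filter

noncomputable section

namespace CLThres

variable {d r : ℕ}

open Topology

/-! Write Q for the type, F for the output forest, and P_F, Q_F for the forest laws built from the
marginals of P and Q. P and P_F share their node marginals and their edge marginals on F, and the
logarithm of a positive law Markov on F sees nothing else. Hence D(P‖R) - D(P‖P_F) = D(P_F‖R) for
such R (`klDiv_sub_klDiv_forestLaw`).

Upper exponent. Suppose all node and pair marginals of Q lie within divergence δ of those of P. For
small δ and ε the strict comparisons between edge weights are the same for P and Q, and every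
discarded edge has zero information under P. So F has maximal weight for P, and the risk is at most
D(P‖Q_F) - D(P‖P_F), which is the sum over nodes of N_i = D(P_i‖Q_i) plus the sum over edges of
D(P_ij‖Q_ij) - N_i - N_j. Edges and isolated vertices of a nonempty forest number at most d - 1, so
this is at most d - 1 pair or node divergences. Reversing their arguments costs a factor d/(d-1)
near P, for a total of dδ (`risk_le_of_relEnt_le`, `exists_risk_bound`). A risk above dδ therefore
forces some marginal to deviate by δ, which the method of types bounds by a polynomial times
exp(-nδ) (`pi_real_relEnt_ge_le`).

Lower exponent. For any forest, the Pythagorean identity and data processing give risk at least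
d(P_i(a)‖Q_i(a)), with d(·‖·) the binary divergence (`binKL_le_risk`). Take a letter with s = P_i(a)
≤ 1/2 and t < s with d(s‖t) slightly above δd. The empirical frequency of a is close to t with
exponent d(t‖s), and d(t‖s) ≤ d(s‖t) because t < s ≤ 1/2 (`binKL_le_binKL_swap`). -/

/-! ### Sums and marginals of laws on a finite product -/

theorem real_setOf_eq_sum (μ : Measure (Fin d → Fin r)) [IsFiniteMeasure μ]
    (p : (Fin d → Fin r) → Prop) [DecidablePred p] :
    μ.real {x | p x} = ∑ x, if p x then μ.real {x} else 0 := by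
  rw [← Finset.sum_filter, sum_measureReal_singleton]
  congr 1
  ext x
  simp

theorem sum_real_singleton (μ : Measure (Fin d → Fin r)) [IsProbabilityMeasure μ] :
    ∑ x, μ.real {x} = 1 := by
  rw [sum_measureReal_singleton]
  simp

theorem nodeMarginal_nonneg (μ : Measure (Fin d → Fin r)) (i : Fin d) (a : Fin r) :
    0 ≤ nodeMarginal μ i a := measureReal_nonneg

theorem pairMarginal_nonneg (μ : Measure (Fin d → Fin r)) (i j : Fin d) (a b : Fin r) :
    0 ≤ pairMarginal μ i j a b := measureReal_nonneg

section Finite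

variable (μ : Measure (Fin d → Fin r)) [IsFiniteMeasure μ]

theorem sum_mul_node (i : Fin d) (g : Fin r → ℝ) :
    ∑ x, μ.real {x} * g (x i) = ∑ a, nodeMarginal μ i a * g a := by
  simp only [nodeMarginal, real_setOf_eq_sum, Finset.sum_mul]
  rw [Finset.sum_comm]
  refine Finset.sum_congr rfl fun x _ => ?_
  simp [ite_mul]

theorem sum_mul_pair (i j : Fin d) (g : Fin r → Fin r → ℝ) :
    ∑ x, μ.real {x} * g (x i) (x j) = ∑ a, ∑ b, pairMarginal μ i j a b * g a b := by
  simp only [pairMarginal, real_setOf_eq_sum, Finset.sum_mul]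
  have : ∀ a : Fin r, ∑ b : Fin r, ∑ x : Fin d → Fin r,
      (if x i = a ∧ x j = b then μ.real {x} else 0) * g a b =
      ∑ x : Fin d → Fin r, if x i = a then μ.real {x} * g a (x j) else 0 := by
    intro a
    rw [Finset.sum_comm]
    refine Finset.sum_congr rfl fun x _ => ?_
    by_cases h : x i = a <;> simp [h, ite_mul]
  simp only [this]
  rw [Finset.sum_comm]
  refine Finset.sum_congr rfl fun x _ => ?_
  simp

theorem sum_pairMarginal_right (i j : Fin d) (a : Fin r) :
    ∑ b, pairMarginal μ i j a b = nodeMarginal μ i a := by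
  have h1 := sum_mul_pair μ i j (fun a' _ => if a' = a then 1 else 0)
  have h2 := sum_mul_node μ i (fun a' => if a' = a then 1 else 0)
  simp only [mul_ite, mul_one, mul_zero, Finset.sum_ite_eq', Finset.mem_univ, if_true] at h1 h2
  rw [← h2, h1, Finset.sum_comm]
  simp

theorem sum_pairMarginal_left (i j : Fin d) (b : Fin r) :
    ∑ a, pairMarginal μ i j a b = nodeMarginal μ j b := by
  simp only [pairMarginal_swap μ i j]
  exact sum_pairMarginal_right μ j i b

theorem pairMarginal_le_left (i j : Fin d) (a b : Fin r) :
    pairMarginal μ i j a b ≤ nodeMarginal μ i a :=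
  measureReal_mono (fun _ hx => hx.1)

theorem pairMarginal_le_right (i j : Fin d) (a b : Fin r) :
    pairMarginal μ i j a b ≤ nodeMarginal μ j b :=
  measureReal_mono (fun _ hx => hx.2)

theorem pairMarginal_eq_zero_left {i : Fin d} (j : Fin d) {a : Fin r} (b : Fin r)
    (h : nodeMarginal μ i a = 0) : pairMarginal μ i j a b = 0 :=
  le_antisymm (h ▸ pairMarginal_le_left μ i j a b) (pairMarginal_nonneg μ i j a b)

theorem pairMarginal_eq_zero_right (i : Fin d) {j : Fin d} (a : Fin r) {b : Fin r}
    (h : nodeMarginal μ j b = 0) : pairMarginal μ i j a b = 0 :=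
  le_antisymm (h ▸ pairMarginal_le_right μ i j a b) (pairMarginal_nonneg μ i j a b)

end Finite

theorem sum_nodeMarginal (μ : Measure (Fin d → Fin r)) [IsProbabilityMeasure μ] (i : Fin d) :
    ∑ a, nodeMarginal μ i a = 1 := by
  have h := sum_mul_node μ i (fun _ => 1)
  simp only [mul_one, sum_real_singleton] at h
  exact h.symm

theorem sum_sum_pairMarginal (μ : Measure (Fin d → Fin r)) [IsProbabilityMeasure μ]
    (i j : Fin d) : ∑ a, ∑ b, pairMarginal μ i j a b = 1 := by
  simp only [sum_pairMarginal_right, sum_nodeMarginal]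

theorem nodeMarginal_pos_of_pairMarginal_pos (hd : 2 ≤ d) (hr : 0 < r)
    (P : Measure (Fin d → Fin r)) [IsFiniteMeasure P]
    (hP : ∀ i j : Fin d, i ≠ j → ∀ a b : Fin r, 0 < pairMarginal P i j a b)
    (i : Fin d) (a : Fin r) : 0 < nodeMarginal P i a := by
  have : Nontrivial (Fin d) := Fin.nontrivial_iff_two_le.mpr hd
  obtain ⟨j, hj⟩ := exists_ne i
  exact (hP i j hj.symm a ⟨0, hr⟩).trans_le (pairMarginal_le_left P i j a _)

/-! ### Leaves and edge counts of forests -/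

theorem exists_leaf {V : Type*} [Finite V] {G : SimpleGraph V} (hG : G.IsAcyclic) (hne : G ≠ ⊥) :
    ∃ v u, G.Adj v u ∧ ∀ w, G.Adj v w → w = u := by
  classical
  have := Fintype.ofFinite V
  obtain ⟨a, b, hab⟩ := SimpleGraph.ne_bot_iff_exists_adj.mp hne
  have htree := hG.isTree_connectedComponent (G.connectedComponentMk a)
  have hb : b ∈ (G.connectedComponentMk a).supp := by
    simpa [SimpleGraph.ConnectedComponent.mem_supp_iff] using hab.symm.reachable
  have : Nontrivial (G.connectedComponentMk a) :=
    ⟨⟨⟨a, rfl⟩, ⟨b, hb⟩, fun h => hab.ne (congrArg Subtype.val h)⟩⟩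
  obtain ⟨⟨v, hv⟩, hdeg⟩ := htree.exists_vert_degree_one_of_nontrivial
  obtain ⟨⟨u, hu⟩, hvu, huniq⟩ := SimpleGraph.degree_eq_one_iff_existsUnique_adj.mp hdeg
  refine ⟨v, u, hvu, fun w hw => ?_⟩
  have hw' : w ∈ (G.connectedComponentMk a).supp :=
    SimpleGraph.ConnectedComponent.mem_supp_of_adj_mem_supp _ hv hw
  exact congrArg Subtype.val (huniq ⟨w, hw'⟩ hw)

/-- Deleting the edge at a leaf loses one edge and isolates at least the leaf, so induction ends at
a single edge. The `+ 1` is what later leaves room for the factor d/(d-1). -/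
theorem ncard_edgeSet_add_ncard_isolated {V : Type*} [Finite V] {F : SimpleGraph V}
    (hF : F.IsAcyclic) (hne : F ≠ ⊥) :
    F.edgeSet.ncard + {v | ∀ w, ¬ F.Adj v w}.ncard + 1 ≤ Nat.card V := by
  induction h : F.edgeSet.ncard using Nat.strong_induction_on generalizing F with
  | _ n ih =>
  obtain ⟨v, u, hvu, huniq⟩ := exists_leaf hF hne
  have hle : F.deleteEdges {s(v, u)} ≤ F := F.deleteEdges_le _
  have hadj : ∀ x y, (F.deleteEdges {s(v, u)}).Adj x y ↔ F.Adj x y ∧ s(x, y) ≠ s(v, u) := by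
    simp [SimpleGraph.deleteEdges_adj]
  have hcard : (F.deleteEdges {s(v, u)}).edgeSet.ncard + 1 = F.edgeSet.ncard := by
    rw [SimpleGraph.edgeSet_deleteEdges]
    exact Set.ncard_sdiff_singleton_add_one hvu (Set.toFinite _)
  by_cases hbot : F.deleteEdges {s(v, u)} = ⊥
  · have h1 : F.edgeSet.ncard = 1 := by
      rw [← hcard]; simp [hbot]
    have h2 : {v | ∀ w, ¬ F.Adj v w} ⊆ ({v, u} : Set V)ᶜ := by
      intro x hx
      simp only [Set.mem_compl_iff, Set.mem_insert_iff, Set.mem_singleton_iff, not_or]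
      exact ⟨fun e => hx u (e ▸ hvu), fun e => hx v (e ▸ hvu.symm)⟩
    have h3 := Set.ncard_le_ncard h2
    have h4 := Set.ncard_add_ncard_compl ({v, u} : Set V)
    rw [Set.ncard_pair hvu.ne] at h4
    omega
  · have := ih _ (by omega) (hF.anti hle) hbot rfl
    have h2 : insert v {v | ∀ w, ¬ F.Adj v w} ⊆
        {x | ∀ w, ¬ (F.deleteEdges {s(v, u)}).Adj x w} := by
      rintro x (rfl | hx)
      · intro w hw
        rw [hadj] at hw
        exact hw.2 (by rw [huniq w hw.1])
      · exact fun w hw => hx w (hle hw)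
    have h3 := Set.ncard_le_ncard h2
    have hv : v ∉ {v | ∀ w, ¬ F.Adj v w} := fun hx => hx u hvu
    rw [Set.ncard_insert_of_notMem hv] at h3
    omega

/-! ### The forest law and its marginals -/

open Classical in
/-- The mass function of `forestLaw`. -/
def forestDensity (μ : Measure (Fin d → Fin r)) (F : SimpleGraph (Fin d))
    (x : Fin d → Fin r) : ℝ :=
  (∏ i : Fin d, nodeMarginal μ i (x i)) * ∏ e ∈ F.edgeFinset, edgeFactor μ x e

theorem edgeFactor_mk (μ : Measure (Fin d → Fin r)) (x : Fin d → Fin r) (i j : Fin d) :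
    edgeFactor μ x s(i, j) = pairMarginal μ i j (x i) (x j) /
      (nodeMarginal μ i (x i) * nodeMarginal μ j (x j)) := rfl

theorem edgeInfo_mk (μ : Measure (Fin d → Fin r)) (i j : Fin d) :
    edgeInfo μ s(i, j) = mutualInfo μ i j := rfl

theorem edgeFactor_congr (μ : Measure (Fin d → Fin r)) {x y : Fin d → Fin r} {e : Sym2 (Fin d)}
    (h : ∀ i ∈ e, x i = y i) : edgeFactor μ x e = edgeFactor μ y e := by
  induction e with
  | _ i j => rw [edgeFactor_mk, edgeFactor_mk, h i (by simp), h j (by simp)]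

theorem edgeFactor_nonneg (μ : Measure (Fin d → Fin r)) (x : Fin d → Fin r)
    (e : Sym2 (Fin d)) : 0 ≤ edgeFactor μ x e := by
  induction e with
  | _ i j =>
    exact div_nonneg (pairMarginal_nonneg _ _ _ _ _)
      (mul_nonneg (nodeMarginal_nonneg _ _ _) (nodeMarginal_nonneg _ _ _))

theorem forestDensity_nonneg (μ : Measure (Fin d → Fin r)) (F : SimpleGraph (Fin d))
    (x : Fin d → Fin r) : 0 ≤ forestDensity μ F x :=
  mul_nonneg (Finset.prod_nonneg fun _ _ => nodeMarginal_nonneg _ _ _)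
    (Finset.prod_nonneg fun _ _ => edgeFactor_nonneg _ _ _)

theorem forestDensity_eq_zero {μ : Measure (Fin d → Fin r)} (F : SimpleGraph (Fin d))
    {x : Fin d → Fin r} {i : Fin d} (h : nodeMarginal μ i (x i) = 0) :
    forestDensity μ F x = 0 := by
  rw [forestDensity, Finset.prod_eq_zero (Finset.mem_univ i) h, zero_mul]

theorem forestDensity_bot (μ : Measure (Fin d → Fin r)) (x : Fin d → Fin r) :
    forestDensity μ ⊥ x = ∏ i, nodeMarginal μ i (x i) := by
  exact (congrArg _ (Finset.prod_eq_one (by simp))).trans (mul_one _)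

theorem forestDensity_deleteEdges (μ : Measure (Fin d → Fin r)) {F : SimpleGraph (Fin d)}
    {u v : Fin d} (huv : F.Adj u v) (x : Fin d → Fin r) :
    forestDensity μ F x =
      forestDensity μ (F.deleteEdges {s(u, v)}) x * edgeFactor μ x s(u, v) := by
  classical
  rw [forestDensity, forestDensity, mul_assoc]
  congr 1
  rw [← Finset.prod_erase_mul F.edgeFinset _ (a := s(u, v)) (by simpa using huv)]
  congr 1
  refine Finset.prod_congr ?_ fun _ _ => rfl
  ext e
  simp [SimpleGraph.edgeSet_deleteEdges, and_comm]

/-- At an isolated vertex only its own node factor changes. The identity is cross-multiplied because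
a type may have vanishing marginals. -/
theorem forestDensity_update (μ : Measure (Fin d → Fin r)) {F : SimpleGraph (Fin d)} {v : Fin d}
    (hv : ∀ w, ¬ F.Adj v w) (x : Fin d → Fin r) (a : Fin r) :
    nodeMarginal μ v (x v) * forestDensity μ F (Function.update x v a) =
      forestDensity μ F x * nodeMarginal μ v a := by
  classical
  have h1 : ∏ e ∈ F.edgeFinset, edgeFactor μ (Function.update x v a) e =
      ∏ e ∈ F.edgeFinset, edgeFactor μ x e := by
    refine Finset.prod_congr rfl fun e he => edgeFactor_congr μ fun i hi => ?_
    rw [Function.update_of_ne]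
    rintro rfl
    obtain ⟨w, rfl⟩ := hi
    exact hv w (by simpa using he)
  have h2 : ∏ i ∈ Finset.univ.erase v, nodeMarginal μ i (Function.update x v a i) =
      ∏ i ∈ Finset.univ.erase v, nodeMarginal μ i (x i) :=
    Finset.prod_congr rfl fun i hi => by rw [Function.update_of_ne (Finset.ne_of_mem_erase hi)]
  rw [forestDensity, forestDensity, h1, ← Finset.mul_prod_erase _ _ (Finset.mem_univ v),
    ← Finset.mul_prod_erase _ (fun i => nodeMarginal μ i (x i)) (Finset.mem_univ v), h2,
    Function.update_self]
  ring

/-- Resampling one coordinate from a mass function `q` preserves sums. -/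
theorem sum_eq_sum_update (v : Fin d) {q : Fin r → ℝ} (hq : ∑ a, q a = 1)
    (φ : (Fin d → Fin r) → ℝ) :
    ∑ x, φ x = ∑ x, q (x v) * ∑ a, φ (Function.update x v a) := by
  simp only [Finset.mul_sum]
  rw [← Fintype.sum_prod_type' (f := fun x a => q (x v) * φ (Function.update x v a))]
  -- Exchanging the old letter at `v` with the fresh one is an involution of the pairs (x, a).
  have hinv : Function.Involutive
      (fun p : (Fin d → Fin r) × Fin r => (Function.update p.1 v p.2, p.1 v)) := by
    rintro ⟨x, a⟩
    simp
  rw [← Equiv.sum_comp hinv.toPerm]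
  simp only [Function.Involutive.coe_toPerm, Function.update_self, Function.update_idem,
    Function.update_eq_self]
  rw [Fintype.sum_prod_type' (f := fun x a => q a * φ x)]
  simp [← Finset.sum_mul, hq]

/-- Given the rest, a leaf is distributed according to its conditional law given its only neighbour.
Where a node marginal vanishes, so do the pair marginals above it, and division by zero does no
harm. -/
theorem sum_forestDensity_leaf (μ : Measure (Fin d → Fin r)) [IsProbabilityMeasure μ]
    {F : SimpleGraph (Fin d)} {u v : Fin d} (huv : F.Adj u v) (hleaf : ∀ w, F.Adj v w → w = u)
    (h : (Fin d → Fin r) → ℝ) :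
    ∑ x, forestDensity μ F x * h x = ∑ x, forestDensity μ (F.deleteEdges {s(u, v)}) x *
      ∑ a, pairMarginal μ u v (x u) a / nodeMarginal μ u (x u) * h (Function.update x v a) := by
  have hiso : ∀ w, ¬ (F.deleteEdges {s(u, v)}).Adj v w := by
    intro w hw
    rw [SimpleGraph.deleteEdges_adj] at hw
    apply hw.2
    rw [hleaf w hw.1, Sym2.eq_swap]
    rfl
  rw [sum_eq_sum_update v (sum_nodeMarginal μ v)]
  refine Finset.sum_congr rfl fun x _ => ?_
  rw [Finset.mul_sum, Finset.mul_sum]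
  refine Finset.sum_congr rfl fun a _ => ?_
  rw [forestDensity_deleteEdges μ huv, edgeFactor_mk, Function.update_self,
    Function.update_of_ne huv.ne]
  have h1 := forestDensity_update μ hiso x a
  rw [← mul_assoc, ← mul_assoc, h1]
  by_cases ha : nodeMarginal μ v a = 0
  · simp [ha, pairMarginal_eq_zero_right μ u (x u) ha]
  · by_cases hu : nodeMarginal μ u (x u) = 0
    · simp [hu]
    · field_simp

/-- Induction by integrating out a leaf. Test functions not involving the leaf pass to the smaller
forest, and the others reduce to the pair formed by the leaf and its neighbour. -/
theorem forestDensity_marginals (μ : Measure (Fin d → Fin r)) [IsProbabilityMeasure μ]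
    {F : SimpleGraph (Fin d)} (hF : F.IsAcyclic) :
    (∀ (i : Fin d) (g : Fin r → ℝ), ∑ x, forestDensity μ F x * g (x i) =
        ∑ a, nodeMarginal μ i a * g a) ∧
      ∀ i j, F.Adj i j → ∀ g : Fin r → Fin r → ℝ, ∑ x, forestDensity μ F x * g (x i) (x j) =
        ∑ a, ∑ b, pairMarginal μ i j a b * g a b := by
  induction h : F.edgeSet.ncard using Nat.strong_induction_on generalizing F with
  | _ n ih =>
  by_cases hbot : F = ⊥
  · subst hbot
    refine ⟨fun i g => ?_, fun i j hij => hij.elim⟩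
    have h1 : ∀ x : Fin d → Fin r, forestDensity μ ⊥ x * g (x i) =
        ∏ j, nodeMarginal μ j (x j) * (if j = i then g (x j) else 1) := by
      intro x
      rw [forestDensity_bot, Finset.prod_mul_distrib]
      simp
    simp only [h1]
    have h2 := (Fintype.prod_sum
      (f := fun (j : Fin d) (a : Fin r) => nodeMarginal μ j a * (if j = i then g a else 1)))
    rw [← h2]
    rw [Finset.prod_eq_single i]
    · simp
    · intro j _ hj
      simp [hj, sum_nodeMarginal]
    · simp
  obtain ⟨v, u, hvu, hleaf⟩ := exists_leaf hF hbot
  have huv := hvu.symm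
  have hle : F.deleteEdges {s(u, v)} ≤ F := F.deleteEdges_le _
  have hcard : (F.deleteEdges {s(u, v)}).edgeSet.ncard + 1 = F.edgeSet.ncard := by
    rw [SimpleGraph.edgeSet_deleteEdges]
    exact Set.ncard_sdiff_singleton_add_one huv (Set.toFinite _)
  obtain ⟨ih1, ih2⟩ := ih _ (by omega) (hF.anti hle) rfl
  -- The conditional masses add up to 1, except where the node marginal is zero, and there the
  -- density is zero.
  have hsum : ∀ x, forestDensity μ (F.deleteEdges {s(u, v)}) x *
      ∑ a, pairMarginal μ u v (x u) a / nodeMarginal μ u (x u) =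
      forestDensity μ (F.deleteEdges {s(u, v)}) x := by
    intro x
    rw [← Finset.sum_div, sum_pairMarginal_right]
    by_cases hu : nodeMarginal μ u (x u) = 0
    · rw [forestDensity_eq_zero _ hu, zero_mul]
    · rw [div_self hu, mul_one]
  have hind : ∀ f : (Fin d → Fin r) → ℝ, (∀ x a, f (Function.update x v a) = f x) →
      ∑ x, forestDensity μ F x * f x =
        ∑ x, forestDensity μ (F.deleteEdges {s(u, v)}) x * f x := by
    intro f hf
    rw [sum_forestDensity_leaf μ huv hleaf]
    refine Finset.sum_congr rfl fun x _ => ?_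
    simp only [hf, ← Finset.sum_mul]
    rw [← mul_assoc, hsum]
  have hpair : ∀ g : Fin r → Fin r → ℝ, ∑ x, forestDensity μ F x * g (x u) (x v) =
        ∑ a, ∑ b, pairMarginal μ u v a b * g a b := by
    intro g
    rw [sum_forestDensity_leaf μ huv hleaf]
    simp only [Function.update_self, Function.update_of_ne huv.ne]
    rw [ih1 u (fun b => ∑ a, pairMarginal μ u v b a / nodeMarginal μ u b * g b a)]
    refine Finset.sum_congr rfl fun b _ => ?_
    rw [Finset.mul_sum]
    refine Finset.sum_congr rfl fun a _ => ?_
    by_cases hu : nodeMarginal μ u b = 0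
    · simp [hu, pairMarginal_eq_zero_left μ v a hu]
    · field_simp
  refine ⟨fun i g => ?_, fun i j hij g => ?_⟩
  · by_cases hi : i = v
    · subst hi
      rw [hpair (fun _ b => g b), Finset.sum_comm]
      simp [← Finset.sum_mul, sum_pairMarginal_left]
    · rw [hind (fun x => g (x i)) (fun x a => by simp [Function.update_of_ne hi]), ih1]
  · by_cases hi : i = v
    · subst hi
      obtain rfl := hleaf j hij
      rw [hpair (fun a b => g b a), Finset.sum_comm]
      simp only [pairMarginal_swap μ j i]
    · by_cases hj : j = v
      · subst hj
        obtain rfl := hleaf i hij.symm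
        exact hpair g
      · rw [hind (fun x => g (x i) (x j)) (fun x a => by
          simp [Function.update_of_ne hi, Function.update_of_ne hj]), ih2 i j]
        rw [SimpleGraph.deleteEdges_adj]
        refine ⟨hij, fun h => ?_⟩
        rcases Sym2.eq_iff.mp (Set.mem_singleton_iff.mp h) with ⟨_, h⟩ | ⟨h, _⟩
        exacts [hj h, hi h]

theorem sum_forestDensity (hd : 0 < d) (μ : Measure (Fin d → Fin r)) [IsProbabilityMeasure μ]
    {F : SimpleGraph (Fin d)} (hF : F.IsAcyclic) : ∑ x, forestDensity μ F x = 1 := by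
  have h := (forestDensity_marginals μ hF).1 ⟨0, hd⟩ (fun _ => 1)
  simpa [sum_nodeMarginal] using h

theorem forestLaw_eq (μ : Measure (Fin d → Fin r)) (F : SimpleGraph (Fin d)) :
    forestLaw μ F = ∑ x, ENNReal.ofReal (forestDensity μ F x) • Measure.dirac x := rfl

theorem forestLaw_singleton (μ : Measure (Fin d → Fin r)) (F : SimpleGraph (Fin d))
    (x : Fin d → Fin r) : forestLaw μ F {x} = ENNReal.ofReal (forestDensity μ F x) := by
  rw [forestLaw_eq]
  simp [Measure.finsetSum_apply, Set.indicator_apply]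

theorem forestLaw_real_singleton (μ : Measure (Fin d → Fin r)) (F : SimpleGraph (Fin d))
    (x : Fin d → Fin r) : (forestLaw μ F).real {x} = forestDensity μ F x := by
  rw [measureReal_def, forestLaw_singleton, ENNReal.toReal_ofReal (forestDensity_nonneg μ F x)]

theorem isProbabilityMeasure_forestLaw (hd : 0 < d) (μ : Measure (Fin d → Fin r))
    [IsProbabilityMeasure μ] {F : SimpleGraph (Fin d)} (hF : F.IsAcyclic) :
    IsProbabilityMeasure (forestLaw μ F) := by
  constructor
  rw [forestLaw_eq]
  simp only [Measure.finsetSum_apply, Measure.smul_apply, measure_univ, smul_eq_mul, mul_one]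
  rw [← ENNReal.ofReal_sum_of_nonneg (fun x _ => forestDensity_nonneg μ F x),
    sum_forestDensity hd μ hF, ENNReal.ofReal_one]

/-! ### Markov laws on forests -/

/-- The increments of `ℓ` in each coordinate depend only on the neighbouring coordinates. -/
def HasLocalIncrements {ι α : Type*} [DecidableEq ι] (G : SimpleGraph ι)
    (ℓ : (ι → α) → ℝ) : Prop :=
  ∀ (v : ι) (a b : α) (x y : ι → α), (∀ w, G.Adj v w → x w = y w) →
    ℓ (Function.update x v a) - ℓ (Function.update x v b) =
      ℓ (Function.update y v a) - ℓ (Function.update y v b)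

/-- On a forest, local increments make `ℓ` a constant plus functions of single coordinates and of
edges, a case of Hammersley–Clifford. A signed weight whose total, node marginals and edge marginals
vanish therefore annihilates it. -/
theorem sum_mul_eq_zero_of_hasLocalIncrements {ι α : Type*} [Fintype ι] [DecidableEq ι]
    [Fintype α] {G : SimpleGraph ι} (hG : G.IsAcyclic) {ℓ : (ι → α) → ℝ}
    (hℓ : HasLocalIncrements G ℓ) (c : (ι → α) → ℝ) (h0 : ∑ x, c x = 0)
    (h1 : ∀ (i : ι) (g : α → ℝ), ∑ x, c x * g (x i) = 0)
    (h2 : ∀ i j, G.Adj i j → ∀ g : α → α → ℝ, ∑ x, c x * g (x i) (x j) = 0) :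
    ∑ x, c x * ℓ x = 0 := by
  rcases isEmpty_or_nonempty (ι → α) with hemp | ⟨⟨z⟩⟩
  · simp
  induction h : G.edgeSet.ncard using Nat.strong_induction_on generalizing G ℓ with
  | _ n ih =>
  by_cases hbot : G = ⊥
  · subst hbot
    -- Without edges, freezing one more coordinate at `z` changes `ℓ` by a function of that
    -- coordinate alone, which `c` annihilates.
    have key : ∀ S : Finset ι, ∑ x, c x * ℓ x = ∑ x, c x * ℓ (S.piecewise z x) := by
      intro S
      induction S using Finset.induction_on with
      | empty => simp
      | insert v S hv ihS =>
        rw [ihS, ← sub_eq_zero, ← Finset.sum_sub_distrib]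
        rw [← h1 v (fun a => ℓ (Function.update z v a) - ℓ (Function.update z v (z v)))]
        refine Finset.sum_congr rfl fun x _ => ?_
        rw [← mul_sub]
        congr 1
        rw [Finset.piecewise_insert]
        have := hℓ v (x v) (z v) (S.piecewise z x) z (fun w hw => hw.elim)
        rw [← this]
        congr 2
        rw [eq_comm, Function.update_eq_self_iff, Finset.piecewise_eq_of_notMem _ _ _ hv]
    rw [key Finset.univ]
    simp [← Finset.sum_mul, h0]
  obtain ⟨v, u, hvu, hleaf⟩ := exists_leaf hG hbot
  have hle : G.deleteEdges {s(v, u)} ≤ G := G.deleteEdges_le _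
  have hcard : (G.deleteEdges {s(v, u)}).edgeSet.ncard + 1 = G.edgeSet.ncard := by
    rw [SimpleGraph.edgeSet_deleteEdges]
    exact Set.ncard_sdiff_singleton_add_one hvu (Set.toFinite _)
  -- With the leaf coordinate frozen, the increments at `u` no longer depend on it, so the leaf edge
  -- can be dropped.
  have hdrop : HasLocalIncrements (G.deleteEdges {s(v, u)})
      (fun x => ℓ (Function.update x v (z v))) := by
    intro w a b x y hxy
    by_cases hw : w = v
    · subst hw
      simp
    · simp only [Function.update_comm hw]
      refine hℓ w a b _ _ fun t ht => ?_
      by_cases htv : t = v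
      · subst htv
        simp
      · rw [Function.update_of_ne htv, Function.update_of_ne htv]
        refine hxy t ?_
        rw [SimpleGraph.deleteEdges_adj]
        refine ⟨ht, fun hh => ?_⟩
        rcases Sym2.eq_iff.mp (Set.mem_singleton_iff.mp hh) with ⟨h, _⟩ | ⟨_, h⟩
        exacts [hw h, htv h]
  have hz := ih _ (by omega) (hG.anti hle) hdrop (fun i j hij => h2 i j (hle hij)) rfl
  -- The error made by freezing `v` depends only on the letters at `v` and at its single neighbour
  -- `u`.
  have hg := h2 v u hvu (fun a b => ℓ (Function.update (Function.update z u b) v a) -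
    ℓ (Function.update (Function.update z u b) v (z v)))
  rw [← add_zero 0]
  nth_rewrite 1 [← hz]
  rw [← hg, ← Finset.sum_add_distrib]
  refine Finset.sum_congr rfl fun x _ => ?_
  rw [← mul_add]
  congr 1
  have := hℓ v (x v) (z v) x (Function.update z u (x u)) fun w hw => by
    rw [hleaf w hw, Function.update_self]
  rw [← this, Function.update_eq_self]
  ring

theorem setOf_update_off (i : Fin d) (x : Fin d → Fin r) (a : Fin r) :
    {y : Fin d → Fin r | ∀ j, j ≠ i → y j = Function.update x i a j} =
      {y | ∀ j, j ≠ i → y j = x j} := by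
  ext y
  exact forall₂_congr fun j hj => by rw [Function.update_of_ne hj]

theorem setOf_off_inter (i : Fin d) (x : Fin d → Fin r) :
    {y : Fin d → Fin r | ∀ j, j ≠ i → y j = x j} ∩ {y | y i = x i} = {x} := by
  ext y
  simp only [Set.mem_inter_iff, Set.mem_ofPred_eq, Set.mem_singleton_iff]
  refine ⟨fun h => funext fun j => ?_, fun h => by simp [h]⟩
  by_cases hj : j = i
  · rw [hj, h.2]
  · exact h.1 j hj

/-- The ratio of two probabilities differing only at `v` equals the ratio of the conditional
probabilities of the two letters given the rest, and by the Markov property these depend only on the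
neighbours. -/
theorem hasLocalIncrements_log {Q : Measure (Fin d → Fin r)} [IsProbabilityMeasure Q]
    (hpos : ∀ x, 0 < Q {x}) {G : SimpleGraph (Fin d)} (hQ : IsMarkovOn Q G) :
    HasLocalIncrements G (fun x => Real.log (Q.real {x})) := by
  have hreal : ∀ x, 0 < Q.real {x} := fun x =>
    ENNReal.toReal_pos (hpos x).ne' (measure_ne_top _ _)
  intro v a b x y hxy
  have hSpos : ∀ x : Fin d → Fin r, 0 < Q.real {y | ∀ j, j ≠ v → y j = x j} := fun x =>
    (hreal x).trans_le (measureReal_mono (by simp))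
  have hcond : ∀ x, (ProbabilityTheory.cond Q {y | ∀ j, G.Adj v j → y j = x j}
      {y | y v = x v}).toReal = Q.real {x} / Q.real {y | ∀ j, j ≠ v → y j = x j} := by
    intro x
    rw [hQ v x, ProbabilityTheory.cond_apply (Set.toFinite _).measurableSet, setOf_off_inter,
      ENNReal.toReal_mul, ENNReal.toReal_inv, div_eq_inv_mul]
    rfl
  have hcongr : ∀ a, (ProbabilityTheory.cond Q
        {z | ∀ j, G.Adj v j → z j = Function.update x v a j}
        {z | z v = Function.update x v a v}).toReal =
      (ProbabilityTheory.cond Q {z | ∀ j, G.Adj v j → z j = Function.update y v a j}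
        {z | z v = Function.update y v a v}).toReal := by
    intro a
    rw [Function.update_self, Function.update_self]
    congr 3
    ext z
    refine forall₂_congr fun j hj => ?_
    rw [Function.update_of_ne hj.ne', Function.update_of_ne hj.ne', hxy j hj]
  have hlog : ∀ x a, Real.log (Q.real {Function.update x v a}) =
      Real.log (Q.real {Function.update x v a} /
        Q.real {y | ∀ j, j ≠ v → y j = Function.update x v a j}) +
      Real.log (Q.real {y | ∀ j, j ≠ v → y j = x j}) := by
    intro x a
    rw [setOf_update_off, Real.log_div (hreal _).ne' (hSpos x).ne']
    ring
  simp only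
  rw [hlog x a, hlog x b, hlog y a, hlog y b, ← hcond, ← hcond, ← hcond, ← hcond, hcongr a,
    hcongr b]
  ring

/-- The Markov property of the density in cross-multiplied form. Factors involving `i` agree at `x`
and `y`, and the other factors do not see the letter at `i`. -/
theorem forestDensity_mul_update (μ : Measure (Fin d → Fin r)) (F : SimpleGraph (Fin d))
    (i : Fin d) {x y : Fin d → Fin r} (hi : x i = y i) (hxy : ∀ j, F.Adj i j → x j = y j)
    (a : Fin r) :
    forestDensity μ F x * forestDensity μ F (Function.update y i a) =
      forestDensity μ F y * forestDensity μ F (Function.update x i a) := by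
  classical
  simp only [forestDensity]
  rw [mul_mul_mul_comm, mul_mul_mul_comm (∏ i, nodeMarginal μ i (y i))]
  simp only [← Finset.prod_mul_distrib]
  congr 1
  · refine Finset.prod_congr rfl fun j _ => ?_
    by_cases hj : j = i
    · subst hj
      simp [hi]
    · simp [Function.update_of_ne hj, mul_comm]
  · refine Finset.prod_congr rfl fun e he => ?_
    by_cases hie : i ∈ e
    · obtain ⟨w, rfl⟩ := hie
      have hw : F.Adj i w := by simpa using he
      have hxyw : ∀ j ∈ s(i, w), x j = y j := by
        intro j hj
        rcases Sym2.mem_iff.mp hj with rfl | rfl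
        exacts [hi, hxy _ hw]
      have hup : ∀ j ∈ s(i, w), Function.update x i a j = Function.update y i a j := by
        intro j hj
        rcases Sym2.mem_iff.mp hj with rfl | rfl
        · simp
        · rw [Function.update_of_ne hw.ne', Function.update_of_ne hw.ne', hxy _ hw]
      rw [edgeFactor_congr μ hxyw, edgeFactor_congr μ hup]
    · have hup : ∀ (z : Fin d → Fin r), ∀ j ∈ e, Function.update z i a j = z j := by
        intro z j hj
        rw [Function.update_of_ne]
        rintro rfl
        exact hie hj
      rw [edgeFactor_congr μ (hup x), edgeFactor_congr μ (hup y), mul_comm]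

theorem forestDensity_pos (hd : 2 ≤ d) (hr : 0 < r) (P : Measure (Fin d → Fin r))
    [IsFiniteMeasure P]
    (hP : ∀ i j : Fin d, i ≠ j → ∀ a b : Fin r, 0 < pairMarginal P i j a b)
    (F : SimpleGraph (Fin d)) (x : Fin d → Fin r) : 0 < forestDensity P F x := by
  classical
  have hnode := nodeMarginal_pos_of_pairMarginal_pos hd hr P hP
  refine mul_pos (Finset.prod_pos fun i _ => hnode i _) (Finset.prod_pos fun e he => ?_)
  induction e with
  | _ i j =>
    have hij : F.Adj i j := by simpa using he
    exact div_pos (hP i j hij.ne _ _) (mul_pos (hnode _ _) (hnode _ _))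

theorem isMarkovOn_forestLaw (hd : 0 < d) (μ : Measure (Fin d → Fin r))
    [IsProbabilityMeasure μ] {F : SimpleGraph (Fin d)} (hF : F.IsAcyclic)
    (hpos : ∀ x, 0 < forestDensity μ F x) : IsMarkovOn (forestLaw μ F) F := by
  classical
  have := isProbabilityMeasure_forestLaw hd μ hF
  intro i x
  have hx : 0 < (forestLaw μ F).real {x} := by
    rw [forestLaw_real_singleton]; exact hpos x
  have hmono : ∀ s : Set (Fin d → Fin r), x ∈ s → 0 < (forestLaw μ F).real s := fun s hs =>
    hx.trans_le (measureReal_mono (by simpa using hs))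
  rw [ProbabilityTheory.cond_apply (Set.toFinite _).measurableSet,
    ProbabilityTheory.cond_apply (Set.toFinite _).measurableSet, setOf_off_inter]
  rw [← ENNReal.toReal_eq_toReal_iff' (ENNReal.mul_ne_top (ENNReal.inv_ne_top.mpr
      fun h => (hmono {y | ∀ j, F.Adj i j → y j = x j} (by simp)).ne' (by simp [measureReal_def, h]))
      (measure_ne_top _ _))
    (ENNReal.mul_ne_top (ENNReal.inv_ne_top.mpr
      fun h => (hmono {y | ∀ j, j ≠ i → y j = x j} (by simp)).ne' (by simp [measureReal_def, h]))
      (measure_ne_top _ _))]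
  simp only [ENNReal.toReal_mul, ENNReal.toReal_inv, ← measureReal_def]
  have h1 := hmono {y | ∀ j, F.Adj i j → y j = x j} (by simp)
  have h2 := hmono {y | ∀ j, j ≠ i → y j = x j} (by simp)
  rw [← div_eq_inv_mul, ← div_eq_inv_mul, div_eq_div_iff h1.ne' h2.ne']
  rw [← Set.ofPred_and]
  simp only [real_setOf_eq_sum, forestLaw_real_singleton]
  -- Resampling coordinate `i` from the point mass at `x i` rewrites both conditioning events as
  -- sums over configurations agreeing with `x` at `i`, with an inner sum over letters. The claim
  -- then holds term by term.
  have hq : ∑ a, (if a = x i then (1 : ℝ) else 0) = 1 := by simp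
  rw [sum_eq_sum_update i hq (fun y => if ∀ j, F.Adj i j → y j = x j then _ else _),
    sum_eq_sum_update i hq (fun y => if ∀ j, j ≠ i → y j = x j then _ else _)]
  have h3 : ∀ y : Fin d → Fin r, ((if y i = x i then (1 : ℝ) else 0) *
      ∑ a, if ∀ j, j ≠ i → Function.update y i a j = x j then
        forestDensity μ F (Function.update y i a) else 0) =
      if y = x then ∑ a, forestDensity μ F (Function.update x i a) else 0 := by
    intro y
    by_cases hy : y = x
    · subst hy
      simp only [if_true, one_mul]
      refine Finset.sum_congr rfl fun a _ => if_pos fun j hj => Function.update_of_ne hj _ _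
    · rw [if_neg hy]
      by_cases hyi : y i = x i
      · refine mul_eq_zero_of_right _ (Finset.sum_eq_zero fun a _ => if_neg fun hh => hy ?_)
        funext j
        by_cases hj : j = i
        · rw [hj, hyi]
        · rw [← hh j hj, Function.update_of_ne hj]
      · simp [hyi]
  simp only [h3, Finset.sum_ite_eq', Finset.mem_univ, if_true]
  rw [Finset.sum_mul, Finset.mul_sum]
  refine Finset.sum_congr rfl fun y _ => ?_
  by_cases hyi : y i = x i
  · by_cases hy : ∀ j, F.Adj i j → y j = x j
    · rw [if_pos ⟨hy, hyi⟩, if_pos hyi, one_mul, Finset.mul_sum, Finset.mul_sum]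
      refine Finset.sum_congr rfl fun a _ => ?_
      rw [if_pos fun j hj => by rw [Function.update_of_ne hj.ne', hy j hj]]
      exact forestDensity_mul_update μ F i hyi hy a
    · rw [if_neg fun h => hy h.1, zero_mul, Finset.sum_eq_zero, mul_zero, mul_zero]
      refine fun a _ => if_neg fun h => hy fun j hj => ?_
      rw [← h j hj, Function.update_of_ne hj.ne']
  · simp [hyi]

theorem isForestStructured_forestLaw (hd : 2 ≤ d) (hr : 0 < r) (P : Measure (Fin d → Fin r))
    [IsProbabilityMeasure P]
    (hP : ∀ i j : Fin d, i ≠ j → ∀ a b : Fin r, 0 < pairMarginal P i j a b)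
    {F : SimpleGraph (Fin d)} (hF : F.IsAcyclic) : IsForestStructured (forestLaw P F) := by
  refine ⟨isProbabilityMeasure_forestLaw (by omega) P hF, fun x => ?_, F, hF,
    isMarkovOn_forestLaw (by omega) P hF (forestDensity_pos hd hr P hP F)⟩
  rw [forestLaw_singleton]
  exact ENNReal.ofReal_pos.mpr (forestDensity_pos hd hr P hP F x)

/-! ### Inequalities for relative entropy -/

-- Termwise comparison of the two directions of divergence, with u = q/p. For u ≥ 1 it follows from
-- log u ≥ 2(u-1)/(u+1). For u ≤ 1 the inequality x ≤ sinh x at x = log(1/u) gives it with factor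
-- 1/u, and 1/u ≤ c.
open InformationTheory in
theorem sub_one_sub_log_le_klFun {u c : ℝ} (hu : 0 < u) (hc : 1 ≤ c) (hcu : 1 ≤ c * u) :
    u - 1 - Real.log u ≤ c * klFun u := by
  rw [klFun_apply]
  have h0 : 0 ≤ u * Real.log u + 1 - u := by
    rw [← klFun_apply]; exact klFun_nonneg hu.le
  rcases le_total 1 u with h1 | h1
  · have h := Real.le_log_one_add_of_nonneg (sub_nonneg.mpr h1)
    rw [div_le_iff₀ (by linarith), add_sub_cancel] at h
    nlinarith
  · have h := Real.self_le_sinh_iff.mpr (Real.log_nonneg ((one_le_inv₀ hu).mpr h1))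
    rw [Real.sinh_log (inv_pos.mpr hu), inv_inv, Real.log_inv] at h
    have h2 : u * (u - 1 - Real.log u) ≤ u * Real.log u + 1 - u := by
      have h3 := mul_le_mul_of_nonneg_left h hu.le
      have h4 : u * ((u⁻¹ - u) / 2) = (1 - u * u) / 2 := by field_simp
      rw [h4] at h3
      linarith
    have h5 : 0 ≤ u - 1 - Real.log u := by
      have := Real.log_le_sub_one_of_pos hu; linarith
    nlinarith [mul_le_mul_of_nonneg_left h2 (by linarith : 0 ≤ c)]

open InformationTheory in
theorem sq_sqrt_sub_one_le_klFun {u : ℝ} (hu : 0 ≤ u) : (√u - 1) ^ 2 ≤ klFun u := by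
  rw [klFun_apply]
  rcases hu.eq_or_lt with rfl | hu
  · simp
  have hs := Real.sqrt_pos.mpr hu
  have h1 := Real.one_sub_inv_le_log_of_pos hs
  rw [Real.log_sqrt hu.le] at h1
  have h2 : u * (√u)⁻¹ = √u := by
    rw [← div_eq_mul_inv, Real.div_sqrt]
  have h3 := mul_le_mul_of_nonneg_left h1 hu.le
  rw [mul_sub, h2] at h3
  have h4 := Real.sq_sqrt hu.le
  nlinarith

section RelEnt

variable {A : Type*} [Fintype A]

/-- Relative entropy of two mass functions on a finite type. -/
def relEnt (p q : A → ℝ) : ℝ := ∑ a, p a * Real.log (p a / q a)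

open InformationTheory in
theorem relEnt_eq_sum_klFun {p q : A → ℝ} (hq : ∀ a, 0 < q a) (hpq : ∑ a, p a = ∑ a, q a) :
    relEnt p q = ∑ a, q a * klFun (p a / q a) := by
  have h : ∀ a, q a * klFun (p a / q a) = p a * Real.log (p a / q a) + (q a - p a) := by
    intro a
    rw [klFun_apply]
    have := (hq a).ne'
    field_simp
    ring
  simp only [h, Finset.sum_add_distrib, Finset.sum_sub_distrib, hpq, sub_self, add_zero, relEnt]

-- The form with `klFun` has nonnegative summands, since the added terms q - p sum to zero.
open InformationTheory in
theorem relEnt_nonneg {p q : A → ℝ} (hp : ∀ a, 0 ≤ p a) (hq : ∀ a, 0 < q a)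
    (hpq : ∑ a, p a = ∑ a, q a) : 0 ≤ relEnt p q := by
  rw [relEnt_eq_sum_klFun hq hpq]
  exact Finset.sum_nonneg fun a _ => mul_nonneg (hq a).le
    (klFun_nonneg (div_nonneg (hp a) (hq a).le))

open InformationTheory in
theorem eq_of_relEnt_eq_zero {p q : A → ℝ} (hp : ∀ a, 0 ≤ p a) (hq : ∀ a, 0 < q a)
    (hpq : ∑ a, p a = ∑ a, q a) (h : relEnt p q = 0) (a : A) : p a = q a := by
  rw [relEnt_eq_sum_klFun hq hpq, Finset.sum_eq_zero_iff_of_nonneg fun a _ =>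
    mul_nonneg (hq a).le (klFun_nonneg (div_nonneg (hp a) (hq a).le))] at h
  have h1 := h a (Finset.mem_univ a)
  rw [mul_eq_zero, or_iff_right (hq a).ne', klFun_eq_zero_iff (div_nonneg (hp a) (hq a).le),
    div_eq_one_iff_eq (hq a).ne'] at h1
  exact h1

-- One term of the Hellinger distance, itself dominated by the divergence. It turns small divergence
-- into pointwise closeness and tolerates zeros of `p`.
open InformationTheory in
theorem sq_sqrt_sub_sqrt_le_relEnt {p q : A → ℝ} (hp : ∀ a, 0 ≤ p a) (hq : ∀ a, 0 < q a)
    (hpq : ∑ a, p a = ∑ a, q a) (a : A) : (√(p a) - √(q a)) ^ 2 ≤ relEnt p q := by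
  rw [relEnt_eq_sum_klFun hq hpq]
  refine le_trans ?_ (Finset.single_le_sum (f := fun a => q a * klFun (p a / q a)) (fun a _ =>
    mul_nonneg (hq a).le (klFun_nonneg (div_nonneg (hp a) (hq a).le))) (Finset.mem_univ a))
  have h := sq_sqrt_sub_one_le_klFun (div_nonneg (hp a) (hq a).le)
  refine le_trans (le_of_eq ?_) (mul_le_mul_of_nonneg_left h (hq a).le)
  have hs := Real.sqrt_pos.mpr (hq a)
  rw [Real.sqrt_div (hp a)]
  nth_rewrite 2 [← Real.sq_sqrt (hq a).le]
  field_simp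

open InformationTheory in
theorem relEnt_le_mul_relEnt {p q : A → ℝ} (hp : ∀ a, 0 < p a) (hq : ∀ a, 0 < q a)
    (hpq : ∑ a, p a = ∑ a, q a) {c : ℝ} (hc : 1 ≤ c) (hcq : ∀ a, p a ≤ c * q a) :
    relEnt p q ≤ c * relEnt q p := by
  rw [relEnt_eq_sum_klFun hp hpq.symm, Finset.mul_sum]
  have h : relEnt p q = ∑ a, p a * (q a / p a - 1 - Real.log (q a / p a)) := by
    have h1 : ∀ a, p a * (q a / p a - 1 - Real.log (q a / p a)) =
        p a * Real.log (p a / q a) + (q a - p a) := by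
      intro a
      rw [← inv_div (q a) (p a), Real.log_inv]
      have := (hp a).ne'
      field_simp
      ring
    simp only [h1, Finset.sum_add_distrib, Finset.sum_sub_distrib, hpq, sub_self, add_zero, relEnt]
  rw [h]
  refine Finset.sum_le_sum fun a _ => ?_
  rw [mul_left_comm]
  refine mul_le_mul_of_nonneg_left (sub_one_sub_log_le_klFun (div_pos (hq a) (hp a)) hc ?_)
    (hp a).le
  rw [← mul_div_assoc, le_div_iff₀ (hp a), one_mul]
  exact hcq a

end RelEnt

/-- The log-sum inequality. -/
theorem log_sum_le {A : Type*} (S : Finset A) {u v : A → ℝ} (hu : ∀ a, 0 < u a)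
    (hv : ∀ a, 0 < v a) :
    (∑ a ∈ S, u a) * Real.log ((∑ a ∈ S, u a) / ∑ a ∈ S, v a) ≤
      ∑ a ∈ S, u a * Real.log (u a / v a) := by
  rcases S.eq_empty_or_nonempty with rfl | hS
  · simp
  have hU : 0 < ∑ a ∈ S, u a := Finset.sum_pos (fun a _ => hu a) hS
  have hV : 0 < ∑ a ∈ S, v a := Finset.sum_pos (fun a _ => hv a) hS
  set U := ∑ a ∈ S, u a with hUdef
  set V := ∑ a ∈ S, v a with hVdef
  -- The tangent bound log y ≤ y - 1 at the ratio of U/V to u/v; the corrections cancel in the sum.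
  have h : ∀ a, u a * Real.log (U / V) + (u a - v a * (U / V)) ≤
      u a * Real.log (u a / v a) := by
    intro a
    have h1 := Real.log_le_sub_one_of_pos (div_pos (div_pos hU hV) (div_pos (hu a) (hv a)))
    rw [Real.log_div (div_pos hU hV).ne' (div_pos (hu a) (hv a)).ne'] at h1
    have h2 := mul_le_mul_of_nonneg_left h1 (hu a).le
    have h3 : u a * (U / V / (u a / v a) - 1) = v a * (U / V) - u a := by
      have := (hu a).ne'; have := (hv a).ne'
      field_simp
    rw [h3] at h2
    linarith
  have h4 := Finset.sum_le_sum fun a (_ : a ∈ S) => h a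
  rw [Finset.sum_add_distrib, Finset.sum_sub_distrib, ← Finset.sum_mul, ← Finset.sum_mul,
    ← hUdef, ← hVdef, mul_div_cancel₀ _ hV.ne', sub_self, add_zero] at h4
  exact h4

/-! ### Binary relative entropy -/

/-- Binary relative entropy. -/
def binKL (s t : ℝ) : ℝ := s * Real.log (s / t) + (1 - s) * Real.log ((1 - s) / (1 - t))

theorem binKL_anti_right {s t t₀ : ℝ} (ht : 0 < t) (htt : t ≤ t₀) (hts : t₀ ≤ s) (hs : s < 1) :
    binKL s t₀ ≤ binKL s t := by
  have h0 : 0 < t₀ := ht.trans_le htt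
  have h1 : 0 < 1 - t₀ := by linarith
  have h2 : 0 < 1 - t := by linarith
  have h3 : 0 < 1 - s := by linarith
  have h4 : 0 < s := by linarith
  unfold binKL
  rw [Real.log_div h4.ne' h0.ne', Real.log_div h4.ne' ht.ne', Real.log_div h3.ne' h1.ne',
    Real.log_div h3.ne' h2.ne']
  have h5 := Real.one_sub_inv_le_log_of_pos (div_pos h0 ht)
  have h6 := Real.one_sub_inv_le_log_of_pos (div_pos h1 h2)
  rw [Real.log_div h0.ne' ht.ne', inv_div] at h5
  rw [Real.log_div h1.ne' h2.ne', inv_div] at h6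
  have h7 := mul_le_mul_of_nonneg_left h5 h4.le
  have h8 := mul_le_mul_of_nonneg_left h6 h3.le
  have h9 : 0 ≤ s * (1 - t / t₀) + (1 - s) * (1 - (1 - t) / (1 - t₀)) := by
    have : s * (1 - t / t₀) + (1 - s) * (1 - (1 - t) / (1 - t₀)) =
        (t₀ - t) * (s - t₀) / (t₀ * (1 - t₀)) := by
      field_simp
      ring
    rw [this]
    exact div_nonneg (mul_nonneg (by linarith) (by linarith)) (mul_pos h0 h1).le
  linarith

/-- The function artanh(x)/x is increasing, because its power series has nonnegative coefficients.
-/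
theorem mul_log_sub_log_le {x y : ℝ} (hy : 0 ≤ y) (hyx : y ≤ x) (hx : x < 1) :
    x * (Real.log (1 + y) - Real.log (1 - y)) ≤ y * (Real.log (1 + x) - Real.log (1 - x)) := by
  have hx0 := hy.trans hyx
  have h1 := (Real.hasSum_log_sub_log_of_abs_lt_one (x := y)
    (by rw [abs_of_nonneg hy]; linarith)).mul_left x
  have h2 := (Real.hasSum_log_sub_log_of_abs_lt_one (x := x)
    (by rw [abs_of_nonneg hx0]; exact hx)).mul_left y
  refine hasSum_le (fun k => ?_) h1 h2
  have h3 : y ^ (2 * k) ≤ x ^ (2 * k) := pow_le_pow_left₀ hy hyx _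
  have h4 : 0 ≤ 2 * (1 / (2 * (k : ℝ) + 1)) * (x * y) := by positivity
  calc x * (2 * (1 / (2 * (k : ℝ) + 1)) * y ^ (2 * k + 1))
      = 2 * (1 / (2 * (k : ℝ) + 1)) * (x * y) * y ^ (2 * k) := by ring
    _ ≤ 2 * (1 / (2 * (k : ℝ) + 1)) * (x * y) * x ^ (2 * k) := mul_le_mul_of_nonneg_left h3 h4
    _ = y * (2 * (1 / (2 * (k : ℝ) + 1)) * x ^ (2 * k + 1)) := by ring

/-- With x = (s-t)/(s+t) and y = (s-t)/(2-s-t), the difference of the two sides is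
2(s-t)(artanh(x)/x - artanh(y)/y). Here y ≤ x because s + t ≤ 1, which is where s ≤ 1/2 enters. -/
theorem binKL_le_binKL_swap {s t : ℝ} (ht : 0 < t) (hts : t < s) (hs : s ≤ 1 / 2) :
    binKL t s ≤ binKL s t := by
  have h1 : 0 < s + t := by linarith
  have h2 : 0 < 2 - s - t := by linarith
  have h := mul_log_sub_log_le (x := (s - t) / (s + t)) (y := (s - t) / (2 - s - t))
    (div_nonneg (by linarith) h2.le)
    (div_le_div_of_nonneg_left (by linarith) h1 (by linarith))
    (by rw [div_lt_one h1]; linarith)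
  have e1 : 1 + (s - t) / (s + t) = s * (2 / (s + t)) := by field_simp; ring
  have e2 : 1 - (s - t) / (s + t) = t * (2 / (s + t)) := by field_simp; ring
  have e3 : 1 + (s - t) / (2 - s - t) = (1 - t) * (2 / (2 - s - t)) := by field_simp; ring
  have e4 : 1 - (s - t) / (2 - s - t) = (1 - s) * (2 / (2 - s - t)) := by field_simp; ring
  have p1 : 0 < s := by linarith
  have p3 : 0 < 1 - t := by linarith
  have p4 : 0 < 1 - s := by linarith
  have q1 : 2 / (s + t) ≠ 0 := by positivity
  have q2 : 2 / (2 - s - t) ≠ 0 := by positivity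
  rw [e1, e2, e3, e4, Real.log_mul p1.ne' q1, Real.log_mul ht.ne' q1, Real.log_mul p3.ne' q2,
    Real.log_mul p4.ne' q2, div_mul_eq_mul_div, div_mul_eq_mul_div, div_le_div_iff₀ h1 h2] at h
  have h5 : 0 < s - t := by linarith
  have h6 : (s - t) * ((2 - s - t) * (Real.log (1 - t) - Real.log (1 - s))) ≤
      (s - t) * ((s + t) * (Real.log s - Real.log t)) := by
    linarith
  have h7 := le_of_mul_le_mul_left h6 h5
  unfold binKL
  rw [Real.log_div ht.ne' p1.ne', Real.log_div p1.ne' ht.ne', Real.log_div p3.ne' p4.ne',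
    Real.log_div p4.ne' p3.ne']
  linarith

theorem continuousOn_binKL_right {s : ℝ} (hs0 : 0 < s) (hs : s < 1) :
    ContinuousOn (fun t => binKL s t) (Set.Ioo 0 1) := by
  unfold binKL
  refine ContinuousOn.add (continuousOn_const.mul (ContinuousOn.log ?_ ?_))
    (continuousOn_const.mul (ContinuousOn.log ?_ ?_))
  · exact continuousOn_const.div continuousOn_id fun t ht => ht.1.ne'
  · exact fun t ht => (div_pos hs0 ht.1).ne'
  · exact continuousOn_const.div (continuousOn_const.sub continuousOn_id)
      fun t ht => (sub_pos.mpr ht.2).ne'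
  · exact fun t ht => (div_pos (sub_pos.mpr hs) (sub_pos.mpr ht.2)).ne'

theorem continuousOn_binKL_left {s : ℝ} (hs0 : 0 < s) (hs : s < 1) :
    ContinuousOn (fun t => binKL t s) (Set.Ioo 0 1) := by
  unfold binKL
  refine ContinuousOn.add (continuousOn_id.mul (ContinuousOn.log ?_ ?_))
    ((continuousOn_const.sub continuousOn_id).mul (ContinuousOn.log ?_ ?_))
  · exact continuousOn_id.div_const _
  · exact fun t ht => (div_pos ht.1 hs0).ne'
  · exact (continuousOn_const.sub continuousOn_id).div_const _
  · exact fun t ht => (div_pos (sub_pos.mpr ht.2) (sub_pos.mpr hs)).ne'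

theorem exists_binKL_eq {s c : ℝ} (hs0 : 0 < s) (hs : s < 1) (hc : 0 < c) :
    ∃ t, 0 < t ∧ t < s ∧ binKL s t = c := by
  have h1s : 0 < 1 - s := by linarith
  -- This left endpoint makes the first term of `binKL` equal to c + 1, while the second term is at
  -- least -1.
  have ht1 : 0 < s * Real.exp (-((c + 1) / s)) := by positivity
  have hts : s * Real.exp (-((c + 1) / s)) ≤ s :=
    mul_le_of_le_one_right hs0.le (Real.exp_le_one_iff.mpr (by
      rw [neg_nonpos]; positivity))
  set t₁ := s * Real.exp (-((c + 1) / s)) with ht₁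
  have hlow : c ≤ binKL s t₁ := by
    have h1t : 0 < 1 - t₁ := by linarith
    have e1 : s * Real.log (s / t₁) = c + 1 := by
      rw [ht₁, Real.log_div hs0.ne' (by positivity), Real.log_mul hs0.ne' (by positivity),
        Real.log_exp]
      field_simp
      ring
    have e2 := Real.one_sub_inv_le_log_of_pos (div_pos h1s h1t)
    have e3 := mul_le_mul_of_nonneg_left e2 h1s.le
    rw [inv_div, mul_sub, mul_div_cancel₀ _ h1s.ne'] at e3
    unfold binKL
    rw [e1]
    linarith
  have hss : binKL s s = 0 := by simp [binKL, div_self hs0.ne', div_self h1s.ne']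
  have hcont : ContinuousOn (fun t => binKL s t) (Set.Icc t₁ s) :=
    (continuousOn_binKL_right hs0 hs).mono fun t ht => ⟨ht1.trans_le ht.1, ht.2.trans_lt hs⟩
  obtain ⟨t, ht, hteq⟩ := intermediate_value_Icc' hts hcont
    (show c ∈ Set.Icc (binKL s s) (binKL s t₁) from ⟨hss ▸ hc.le, hlow⟩)
  refine ⟨t, ht1.trans_le ht.1, lt_of_le_of_ne ht.2 ?_, hteq⟩
  rintro rfl
  simp only at hteq
  linarith

/-! ### Divergence from forest laws: Pythagorean identity and Chow–Liu weights -/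

theorem absolutelyContinuous_of_singleton {X : Type*} [Finite X] [MeasurableSpace X]
    [MeasurableSingletonClass X] {μ ν : Measure X} (h : ∀ x, ν {x} = 0 → μ {x} = 0) : μ ≪ ν := by
  intro s hs
  have hs' : s = ⋃ x ∈ s, {x} := by simp
  rw [hs', measure_biUnion_null_iff (Set.toFinite s).countable]
  exact fun x hx => h x (measure_mono_null (by simpa using hx) hs)

theorem klDiv_ne_top_of_finite {X : Type*} [Finite X] [MeasurableSpace X]
    [MeasurableSingletonClass X] {μ ν : Measure X} [IsProbabilityMeasure μ]
    (h : μ ≪ ν) : InformationTheory.klDiv μ ν ≠ ⊤ :=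
  InformationTheory.klDiv_ne_top h Integrable.of_finite

theorem toReal_klDiv_eq_sum {X : Type*} [Fintype X] [MeasurableSpace X]
    [MeasurableSingletonClass X] {μ ν : Measure X} [IsProbabilityMeasure μ]
    [IsProbabilityMeasure ν] (hν : ∀ x, 0 < ν.real {x}) :
    (InformationTheory.klDiv μ ν).toReal =
      ∑ x, μ.real {x} * (Real.log (μ.real {x}) - Real.log (ν.real {x})) := by
  have hac : μ ≪ ν := absolutelyContinuous_of_singleton fun x hx =>
    ((hν x).ne' (by simp [measureReal_def, hx])).elim
  rw [InformationTheory.toReal_klDiv_of_measure_eq hac (by simp),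
    integral_fintype Integrable.of_finite]
  refine Finset.sum_congr rfl fun x _ => ?_
  rw [smul_eq_mul]
  rcases (measureReal_nonneg (μ := μ) (s := {x})).eq_or_lt with h0 | h0
  · rw [← h0]; simp
  congr 1
  have h1 : μ.rnDeriv ν x * ν {x} = μ {x} := by
    rw [← Measure.setLIntegral_rnDeriv hac {x}, lintegral_singleton]
  have h2 : (μ.rnDeriv ν x).toReal * ν.real {x} = μ.real {x} := by
    rw [measureReal_def, measureReal_def, ← h1, ENNReal.toReal_mul]
  rw [llr, eq_div_of_mul_eq (hν x).ne' h2, Real.log_div h0.ne' (hν x).ne']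

/-- The difference between `P` and its forest law has zero node marginals and zero edge marginals on
`G`, so it annihilates log R. -/
theorem sum_mul_log_eq (hd : 0 < d) (P : Measure (Fin d → Fin r)) [IsProbabilityMeasure P]
    {R : Measure (Fin d → Fin r)} [IsProbabilityMeasure R] (hR : ∀ x, 0 < R {x})
    {G : SimpleGraph (Fin d)} (hG : G.IsAcyclic) (hRG : IsMarkovOn R G) :
    ∑ x, P.real {x} * Real.log (R.real {x}) =
      ∑ x, forestDensity P G x * Real.log (R.real {x}) := by
  rw [← sub_eq_zero, ← Finset.sum_sub_distrib]
  simp only [← sub_mul]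
  obtain ⟨hm1, hm2⟩ := forestDensity_marginals P hG
  refine sum_mul_eq_zero_of_hasLocalIncrements hG (hasLocalIncrements_log hR hRG) _ ?_ ?_ ?_
  · rw [Finset.sum_sub_distrib, sum_real_singleton, sum_forestDensity hd P hG, sub_self]
  · intro i g
    simp only [sub_mul]
    rw [Finset.sum_sub_distrib, sum_mul_node, hm1, sub_self]
  · intro i j hij g
    simp only [sub_mul]
    rw [Finset.sum_sub_distrib, sum_mul_pair, hm2 i j hij, sub_self]

theorem real_singleton_pos {R : Measure (Fin d → Fin r)} [IsFiniteMeasure R]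
    (hR : ∀ x, 0 < R {x}) (x : Fin d → Fin r) : 0 < R.real {x} :=
  ENNReal.toReal_pos (hR x).ne' (measure_ne_top _ _)

/-- Pythagorean identity: `D(P ‖ R) - D(P ‖ P_G) = D(P_G ‖ R)`, where `R` is Markov on the forest
`G` and `P_G` is the reverse I-projection of `P` onto `G`. -/
theorem klDiv_sub_klDiv_forestLaw (hd : 2 ≤ d) (hr : 0 < r) (P : Measure (Fin d → Fin r))
    [IsProbabilityMeasure P]
    (hP : ∀ i j : Fin d, i ≠ j → ∀ a b : Fin r, 0 < pairMarginal P i j a b)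
    {R : Measure (Fin d → Fin r)} [IsProbabilityMeasure R] (hR : ∀ x, 0 < R {x})
    {G : SimpleGraph (Fin d)} (hG : G.IsAcyclic) (hRG : IsMarkovOn R G) :
    (InformationTheory.klDiv P R).toReal - (InformationTheory.klDiv P (forestLaw P G)).toReal =
      ∑ x, forestDensity P G x * Real.log (forestDensity P G x / R.real {x}) := by
  obtain ⟨hprob, hpos, -⟩ := isForestStructured_forestLaw hd hr P hP hG
  have hd0 : 0 < d := by omega
  have hdens := forestDensity_pos hd hr P hP G
  have h1 := sum_mul_log_eq hd0 P hR hG hRG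
  have h2 := sum_mul_log_eq hd0 P hpos hG (isMarkovOn_forestLaw hd0 P hG hdens)
  rw [toReal_klDiv_eq_sum (real_singleton_pos hR), toReal_klDiv_eq_sum (real_singleton_pos hpos)]
  simp only [mul_sub, Finset.sum_sub_distrib]
  rw [h1, h2]
  simp only [forestLaw_real_singleton]
  rw [sub_sub_sub_cancel_left, ← Finset.sum_sub_distrib]
  refine Finset.sum_congr rfl fun x _ => ?_
  rw [Real.log_div (hdens x).ne' (real_singleton_pos hR x).ne']
  ring

theorem klDiv_forestLaw_le (hd : 2 ≤ d) (hr : 0 < r) (P : Measure (Fin d → Fin r))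
    [IsProbabilityMeasure P]
    (hP : ∀ i j : Fin d, i ≠ j → ∀ a b : Fin r, 0 < pairMarginal P i j a b)
    {R : Measure (Fin d → Fin r)} [IsProbabilityMeasure R] (hR : ∀ x, 0 < R {x})
    {G : SimpleGraph (Fin d)} (hG : G.IsAcyclic) (hRG : IsMarkovOn R G) :
    (InformationTheory.klDiv P (forestLaw P G)).toReal ≤ (InformationTheory.klDiv P R).toReal := by
  rw [← sub_nonneg, klDiv_sub_klDiv_forestLaw hd hr P hP hR hG hRG]
  have := relEnt_nonneg (p := forestDensity P G) (q := fun x => R.real {x})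
    (fun x => forestDensity_nonneg P G x) (real_singleton_pos hR)
    (by rw [sum_forestDensity (by omega) P hG, sum_real_singleton])
  exact this

open Classical in
theorem log_forestDensity (μ : Measure (Fin d → Fin r)) (F : SimpleGraph (Fin d))
    {x : Fin d → Fin r} (h : 0 < forestDensity μ F x) :
    Real.log (forestDensity μ F x) = ∑ i, Real.log (nodeMarginal μ i (x i)) +
      ∑ e ∈ F.edgeFinset, Real.log (edgeFactor μ x e) := by
  have h1 := left_ne_zero_of_mul h.ne'
  have h2 := right_ne_zero_of_mul h.ne'
  rw [forestDensity, Real.log_mul h1 h2, Real.log_prod (Finset.prod_ne_zero_iff.mp h1),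
    Real.log_prod (Finset.prod_ne_zero_iff.mp h2)]

theorem sum_mul_log_edgeFactor (P : Measure (Fin d → Fin r)) [IsFiniteMeasure P]
    (e : Sym2 (Fin d)) : ∑ x, P.real {x} * Real.log (edgeFactor P x e) = edgeInfo P e := by
  induction e with
  | _ i j =>
    rw [edgeInfo_mk]
    exact sum_mul_pair P i j (fun a b => Real.log (pairMarginal P i j a b /
      (nodeMarginal P i a * nodeMarginal P j b)))

theorem sum_mul_log_forestDensity (P : Measure (Fin d → Fin r)) [IsFiniteMeasure P]
    (F : SimpleGraph (Fin d)) (h : ∀ x, 0 < forestDensity P F x) :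
    ∑ x, P.real {x} * Real.log (forestDensity P F x) =
      ∑ i, ∑ a, nodeMarginal P i a * Real.log (nodeMarginal P i a) + weight P F := by
  classical
  simp only [log_forestDensity P F (h _), mul_add, Finset.sum_add_distrib, Finset.mul_sum]
  rw [Finset.sum_comm]
  congr 1
  · exact Finset.sum_congr rfl fun i _ => sum_mul_node P i (fun a => Real.log (nodeMarginal P i a))
  · rw [Finset.sum_comm, weight]
    exact Finset.sum_congr rfl fun e _ => sum_mul_log_edgeFactor P e

theorem relEnt_pair_product (μ : Measure (Fin d → Fin r)) (i j : Fin d) :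
    relEnt (fun p : Fin r × Fin r => pairMarginal μ i j p.1 p.2)
      (fun p => nodeMarginal μ i p.1 * nodeMarginal μ j p.2) = mutualInfo μ i j := by
  rw [relEnt, mutualInfo, Fintype.sum_prod_type]

theorem sum_prod_pairMarginal (μ : Measure (Fin d → Fin r)) [IsProbabilityMeasure μ]
    (i j : Fin d) : ∑ p : Fin r × Fin r, pairMarginal μ i j p.1 p.2 = 1 := by
  rw [Fintype.sum_prod_type, sum_sum_pairMarginal]

theorem sum_prod_nodeMarginal_mul (μ : Measure (Fin d → Fin r)) [IsProbabilityMeasure μ]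
    (i j : Fin d) : ∑ p : Fin r × Fin r, nodeMarginal μ i p.1 * nodeMarginal μ j p.2 = 1 := by
  rw [Fintype.sum_prod_type, ← Finset.sum_mul_sum, sum_nodeMarginal, sum_nodeMarginal, one_mul]

theorem mutualInfo_nonneg (μ : Measure (Fin d → Fin r)) [IsProbabilityMeasure μ]
    (i j : Fin d) (hi : ∀ a, 0 < nodeMarginal μ i a) (hj : ∀ a, 0 < nodeMarginal μ j a) :
    0 ≤ mutualInfo μ i j := by
  rw [← relEnt_pair_product]
  refine relEnt_nonneg (fun _ => pairMarginal_nonneg _ _ _ _ _)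
    (fun p => mul_pos (hi p.1) (hj p.2)) ?_
  rw [sum_prod_pairMarginal, sum_prod_nodeMarginal_mul]

theorem edgeInfo_nonneg (μ : Measure (Fin d → Fin r)) [IsProbabilityMeasure μ]
    (h : ∀ i a, 0 < nodeMarginal μ i a) (e : Sym2 (Fin d)) : 0 ≤ edgeInfo μ e := by
  induction e with
  | _ i j => exact mutualInfo_nonneg μ i j (h i) (h j)

theorem weight_mono (μ : Measure (Fin d → Fin r)) [IsProbabilityMeasure μ]
    (h : ∀ i a, 0 < nodeMarginal μ i a) {G H : SimpleGraph (Fin d)} (hGH : G ≤ H) :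
    weight μ G ≤ weight μ H := by
  classical
  unfold weight
  exact Finset.sum_le_sum_of_subset_of_nonneg (SimpleGraph.edgeFinset_mono hGH)
    fun e _ _ => edgeInfo_nonneg μ h e

theorem exists_tree_ge (hd : 0 < d) {G : SimpleGraph (Fin d)} (hG : G.IsAcyclic) :
    ∃ T : SimpleGraph (Fin d), T.IsTree ∧ G ≤ T := by
  have : Nonempty (Fin d) := ⟨⟨0, hd⟩⟩
  obtain ⟨T, hGT, -, hT⟩ :=
    SimpleGraph.connected_top.exists_isTree_le_of_le_of_isAcyclic (H := G) le_top hG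
  exact ⟨T, hT, hGT⟩

/-- The Chow–Liu principle: D(P‖P_G) is a constant minus the weight of G, and extending a forest to
a tree does not lower its weight. -/
theorem klDiv_forestLaw_le_of_weight_le (hd : 2 ≤ d) (hr : 0 < r) (P : Measure (Fin d → Fin r))
    [IsProbabilityMeasure P]
    (hP : ∀ i j : Fin d, i ≠ j → ∀ a b : Fin r, 0 < pairMarginal P i j a b)
    {F : SimpleGraph (Fin d)} (hF : F.IsAcyclic)
    (hmax : ∀ T : SimpleGraph (Fin d), T.IsTree → weight P T ≤ weight P F)
    {R : Measure (Fin d → Fin r)} (hR : IsForestStructured R) :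
    (InformationTheory.klDiv P (forestLaw P F)).toReal ≤ (InformationTheory.klDiv P R).toReal := by
  obtain ⟨hprob, hpos, G, hG, hRG⟩ := hR
  refine le_trans ?_ (klDiv_forestLaw_le hd hr P hP hpos hG hRG)
  have hd0 : 0 < d := by omega
  obtain ⟨T, hT, hGT⟩ := exists_tree_ge hd0 hG
  have hw : weight P G ≤ weight P F :=
    (weight_mono P (nodeMarginal_pos_of_pairMarginal_pos hd hr P hP) hGT).trans (hmax T hT)
  have := isProbabilityMeasure_forestLaw hd0 P hG
  have := isProbabilityMeasure_forestLaw hd0 P hF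
  rw [toReal_klDiv_eq_sum, toReal_klDiv_eq_sum]
  · simp only [mul_sub, Finset.sum_sub_distrib, forestLaw_real_singleton]
    rw [sum_mul_log_forestDensity P F (forestDensity_pos hd hr P hP F),
      sum_mul_log_forestDensity P G (forestDensity_pos hd hr P hP G)]
    linarith
  · intro x
    rw [forestLaw_real_singleton]
    exact forestDensity_pos hd hr P hP G x
  · intro x
    rw [forestLaw_real_singleton]
    exact forestDensity_pos hd hr P hP F x

theorem risk_eq_coe {P Ptilde R : Measure (Fin d → Fin r)}
    (h1 : InformationTheory.klDiv P R ≠ ⊤) (h2 : InformationTheory.klDiv P Ptilde ≠ ⊤) :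
    risk P Ptilde R = (((InformationTheory.klDiv P R).toReal -
      (InformationTheory.klDiv P Ptilde).toReal : ℝ) : EReal) := by
  rw [risk, EReal.coe_sub]
  congr 1
  · rw [EReal.coe_ennreal_toReal h1]
  · rw [EReal.coe_ennreal_toReal h2]

theorem klDiv_ne_top_of_pos {P R : Measure (Fin d → Fin r)} [IsProbabilityMeasure P]
    (hR : ∀ x, 0 < R {x}) : InformationTheory.klDiv P R ≠ ⊤ :=
  klDiv_ne_top_of_finite (absolutelyContinuous_of_singleton fun x hx => ((hR x).ne' hx).elim)

theorem exists_real_singleton_pos {P : Measure (Fin d → Fin r)} [IsFiniteMeasure P]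
    {s : Set (Fin d → Fin r)} (h : 0 < P.real s) : ∃ x ∈ s, 0 < P {x} := by
  by_contra! hcon
  have : P s = 0 := by
    have hs' : s = ⋃ x ∈ s, {x} := by simp
    rw [hs', measure_biUnion_null_iff (Set.toFinite s).countable]
    exact fun x hx => le_antisymm (hcon x hx) bot_le
  simp [measureReal_def, this] at h

/-! ### Lower bound on the risk -/

theorem nodeMarginal_pos_of_ac {P Q : Measure (Fin d → Fin r)} [IsFiniteMeasure P]
    {F : SimpleGraph (Fin d)} (hac : P ≪ forestLaw Q F) {i : Fin d} {a : Fin r}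
    (h : 0 < nodeMarginal P i a) : 0 < nodeMarginal Q i a := by
  obtain ⟨x, rfl, hx⟩ := exists_real_singleton_pos h
  refine (nodeMarginal_nonneg Q i (x i)).lt_of_ne' fun h0 => hx.ne' (hac ?_)
  rw [forestLaw_singleton, forestDensity_eq_zero F h0, ENNReal.ofReal_zero]

theorem pairMarginal_pos_of_ac {P Q : Measure (Fin d → Fin r)} [IsFiniteMeasure P]
    {F : SimpleGraph (Fin d)} (hac : P ≪ forestLaw Q F) {i j : Fin d} (hij : F.Adj i j)
    {a b : Fin r} (h : 0 < pairMarginal P i j a b) : 0 < pairMarginal Q i j a b := by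
  classical
  obtain ⟨x, ⟨rfl, rfl⟩, hx⟩ := exists_real_singleton_pos h
  refine (pairMarginal_nonneg Q i j _ _).lt_of_ne' fun h0 => hx.ne' (hac ?_)
  rw [forestLaw_singleton, forestDensity,
    Finset.prod_eq_zero (i := s(i, j)) (by simpa using hij) (by rw [edgeFactor_mk, h0, zero_div]),
    mul_zero, ENNReal.ofReal_zero]

theorem forestDensity_pos_of_ac (hd : 2 ≤ d) (hr : 0 < r) {P Q : Measure (Fin d → Fin r)}
    [IsFiniteMeasure P]
    (hP : ∀ i j : Fin d, i ≠ j → ∀ a b : Fin r, 0 < pairMarginal P i j a b)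
    {F : SimpleGraph (Fin d)} (hac : P ≪ forestLaw Q F) (x : Fin d → Fin r) :
    0 < forestDensity Q F x := by
  classical
  have hnode : ∀ i a, 0 < nodeMarginal Q i a := fun i a =>
    nodeMarginal_pos_of_ac hac (nodeMarginal_pos_of_pairMarginal_pos hd hr P hP i a)
  refine mul_pos (Finset.prod_pos fun i _ => hnode i _) (Finset.prod_pos fun e he => ?_)
  induction e with
  | _ i j =>
    have hij : F.Adj i j := by simpa using he
    exact div_pos (pairMarginal_pos_of_ac hac hij (hP i j hij.ne _ _))
      (mul_pos (hnode _ _) (hnode _ _))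

theorem sum_filter_forestDensity (μ : Measure (Fin d → Fin r)) [IsProbabilityMeasure μ]
    {F : SimpleGraph (Fin d)} (hF : F.IsAcyclic) (i : Fin d) (a : Fin r) :
    ∑ x with x i = a, forestDensity μ F x = nodeMarginal μ i a := by
  have h := (forestDensity_marginals μ hF).1 i (fun b => if b = a then 1 else 0)
  simpa [Finset.sum_filter] using h

/-- Data processing for the partition into x_i = a and its complement. -/
theorem binKL_le_sum_forestDensity (hd : 0 < d) (P Q : Measure (Fin d → Fin r))
    [IsProbabilityMeasure P] [IsProbabilityMeasure Q] {F : SimpleGraph (Fin d)}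
    (hF : F.IsAcyclic) (hPF : ∀ x, 0 < forestDensity P F x) (hQF : ∀ x, 0 < forestDensity Q F x)
    (i : Fin d) (a : Fin r) :
    binKL (nodeMarginal P i a) (nodeMarginal Q i a) ≤
      ∑ x, forestDensity P F x * Real.log (forestDensity P F x / forestDensity Q F x) := by
  have h1 := log_sum_le (Finset.univ.filter fun x : Fin d → Fin r => x i = a) hPF hQF
  have h2 := log_sum_le (Finset.univ.filter fun x : Fin d → Fin r => ¬ x i = a) hPF hQF
  have h3 : ∀ (μ : Measure (Fin d → Fin r)) [IsProbabilityMeasure μ],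
      ∑ x with ¬ x i = a, forestDensity μ F x = 1 - nodeMarginal μ i a := by
    intro μ _
    rw [← sum_forestDensity hd μ hF, ← sum_filter_forestDensity μ hF i a,
      ← Finset.sum_filter_add_sum_filter_not Finset.univ (fun x : Fin d → Fin r => x i = a)]
    ring
  rw [sum_filter_forestDensity P hF, sum_filter_forestDensity Q hF] at h1
  rw [h3, h3] at h2
  rw [← Finset.sum_filter_add_sum_filter_not Finset.univ (fun x : Fin d → Fin r => x i = a)]
  exact add_le_add h1 h2

/-- Minimality of the projection gives D(P‖P̃) ≤ D(P‖P_F), so the risk is at least D(P_F‖Q_F), which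
dominates the binary divergence of a node marginal. If `P` is not absolutely continuous with respect
to the estimate, the risk is infinite. -/
theorem binKL_le_risk (hd : 2 ≤ d) (hr : 0 < r) {P Ptilde Q : Measure (Fin d → Fin r)}
    [IsProbabilityMeasure P] [IsProbabilityMeasure Q]
    (hP : ∀ i j : Fin d, i ≠ j → ∀ a b : Fin r, 0 < pairMarginal P i j a b)
    (hPt : IsForestProjection P Ptilde) {F : SimpleGraph (Fin d)} (hF : F.IsAcyclic)
    {i : Fin d} {a : Fin r} {t : ℝ} (hQt : nodeMarginal Q i a ≤ t) (hts : t ≤ nodeMarginal P i a)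
    (hs : nodeMarginal P i a < 1) :
    ((binKL (nodeMarginal P i a) t : ℝ) : EReal) ≤ risk P Ptilde (forestLaw Q F) := by
  have hd0 : 0 < d := by omega
  have htop := klDiv_ne_top_of_pos (P := P) hPt.1.2.1
  by_cases hac : P ≪ forestLaw Q F
  · have hdensP := forestDensity_pos hd hr P hP F
    have hdens := forestDensity_pos_of_ac hd hr hP hac
    have hQpos : 0 < nodeMarginal Q i a :=
      nodeMarginal_pos_of_ac hac (nodeMarginal_pos_of_pairMarginal_pos hd hr P hP i a)
    have := isProbabilityMeasure_forestLaw hd0 Q hF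
    have hpos : ∀ x, 0 < forestLaw Q F {x} := fun x => by
      rw [forestLaw_singleton]; exact ENNReal.ofReal_pos.mpr (hdens x)
    rw [risk_eq_coe (klDiv_ne_top_of_finite hac) htop, EReal.coe_le_coe_iff]
    have hPF := isForestStructured_forestLaw hd hr P hP hF
    have h1 := ENNReal.toReal_mono (klDiv_ne_top_of_pos (P := P) hPF.2.1) (hPt.2 _ hPF)
    have h2 := klDiv_sub_klDiv_forestLaw hd hr P hP hpos hF (isMarkovOn_forestLaw hd0 Q hF hdens)
    simp only [forestLaw_real_singleton] at h2
    have h3 := binKL_le_sum_forestDensity hd0 P Q hF hdensP hdens i a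
    have h4 := binKL_anti_right hQpos hQt hts hs
    linarith
  · rw [risk, InformationTheory.klDiv_of_not_ac hac, EReal.coe_ennreal_top,
      ← EReal.coe_ennreal_toReal htop, EReal.top_sub_coe]
    exact le_top

/-! ### Upper bound on the risk by pair and node divergences -/

theorem risk_le_sum (hd : 2 ≤ d) (hr : 0 < r) {P Ptilde Q : Measure (Fin d → Fin r)}
    [IsProbabilityMeasure P] [IsProbabilityMeasure Q]
    (hP : ∀ i j : Fin d, i ≠ j → ∀ a b : Fin r, 0 < pairMarginal P i j a b)
    (hQ : ∀ i j : Fin d, i ≠ j → ∀ a b : Fin r, 0 < pairMarginal Q i j a b)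
    (hPt : IsForestStructured Ptilde) {F : SimpleGraph (Fin d)} (hF : F.IsAcyclic)
    (hmax : ∀ T : SimpleGraph (Fin d), T.IsTree → weight P T ≤ weight P F) :
    risk P Ptilde (forestLaw Q F) ≤ ((∑ x, P.real {x} *
      (Real.log (forestDensity P F x) - Real.log (forestDensity Q F x)) : ℝ) : EReal) := by
  have hd0 : 0 < d := by omega
  obtain ⟨hprobQ, hposQ, -⟩ := isForestStructured_forestLaw hd hr Q hQ hF
  obtain ⟨hprobP, hposP, -⟩ := isForestStructured_forestLaw hd hr P hP hF
  rw [risk_eq_coe (klDiv_ne_top_of_pos hposQ) (klDiv_ne_top_of_pos hPt.2.1), EReal.coe_le_coe_iff]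
  have h1 := klDiv_forestLaw_le_of_weight_le hd hr P hP hF hmax hPt
  have h2 := toReal_klDiv_eq_sum (μ := P) (real_singleton_pos hposQ)
  have h3 := toReal_klDiv_eq_sum (μ := P) (real_singleton_pos hposP)
  simp only [forestLaw_real_singleton, mul_sub, Finset.sum_sub_distrib] at h2 h3 ⊢
  linarith

/-- Pairwise marginal as a mass function on pairs of letters. -/
def pairLaw (μ : Measure (Fin d → Fin r)) (i j : Fin d) (p : Fin r × Fin r) : ℝ :=
  pairMarginal μ i j p.1 p.2

theorem sum_pairLaw (μ : Measure (Fin d → Fin r)) [IsProbabilityMeasure μ] (i j : Fin d) :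
    ∑ p, pairLaw μ i j p = 1 := sum_prod_pairMarginal μ i j

theorem sum_mul_log_edgeFactor_sub (hd : 2 ≤ d) (hr : 0 < r) {P Q : Measure (Fin d → Fin r)}
    [IsFiniteMeasure P] [IsFiniteMeasure Q]
    (hP : ∀ i j : Fin d, i ≠ j → ∀ a b : Fin r, 0 < pairMarginal P i j a b)
    (hQ : ∀ i j : Fin d, i ≠ j → ∀ a b : Fin r, 0 < pairMarginal Q i j a b)
    {i j : Fin d} (hij : i ≠ j) :
    ∑ x, P.real {x} * (Real.log (edgeFactor P x s(i, j)) - Real.log (edgeFactor Q x s(i, j))) =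
      relEnt (pairLaw P i j) (pairLaw Q i j) - relEnt (nodeMarginal P i) (nodeMarginal Q i) -
        relEnt (nodeMarginal P j) (nodeMarginal Q j) := by
  have hnP := nodeMarginal_pos_of_pairMarginal_pos hd hr P hP
  have hnQ := nodeMarginal_pos_of_pairMarginal_pos hd hr Q hQ
  have h1 : relEnt (pairLaw P i j) (pairLaw Q i j) = ∑ x, P.real {x} *
      Real.log (pairMarginal P i j (x i) (x j) / pairMarginal Q i j (x i) (x j)) := by
    rw [sum_mul_pair P i j (fun a b => Real.log (pairMarginal P i j a b / pairMarginal Q i j a b)),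
      relEnt, Fintype.sum_prod_type]
    rfl
  have h2 : ∀ i, relEnt (nodeMarginal P i) (nodeMarginal Q i) = ∑ x, P.real {x} *
      Real.log (nodeMarginal P i (x i) / nodeMarginal Q i (x i)) := by
    intro i
    rw [sum_mul_node P i (fun a => Real.log (nodeMarginal P i a / nodeMarginal Q i a)), relEnt]
  rw [h1, h2, h2, ← Finset.sum_sub_distrib, ← Finset.sum_sub_distrib]
  refine Finset.sum_congr rfl fun x _ => ?_
  rw [← mul_sub, ← mul_sub, edgeFactor_mk, edgeFactor_mk,
    Real.log_div (hP i j hij _ _).ne' (mul_pos (hnP _ _) (hnP _ _)).ne',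
    Real.log_div (hQ i j hij _ _).ne' (mul_pos (hnQ _ _) (hnQ _ _)).ne',
    Real.log_mul (hnP _ _).ne' (hnP _ _).ne', Real.log_mul (hnQ _ _).ne' (hnQ _ _).ne',
    Real.log_div (hP i j hij _ _).ne' (hQ i j hij _ _).ne',
    Real.log_div (hnP _ _).ne' (hnQ _ _).ne', Real.log_div (hnP _ _).ne' (hnQ _ _).ne']
  ring

open Classical in
theorem sum_mul_log_forestDensity_sub (hd : 2 ≤ d) (hr : 0 < r) {P Q : Measure (Fin d → Fin r)}
    [IsFiniteMeasure P] [IsFiniteMeasure Q]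
    (hP : ∀ i j : Fin d, i ≠ j → ∀ a b : Fin r, 0 < pairMarginal P i j a b)
    (hQ : ∀ i j : Fin d, i ≠ j → ∀ a b : Fin r, 0 < pairMarginal Q i j a b)
    (F : SimpleGraph (Fin d)) :
    ∑ x, P.real {x} * (Real.log (forestDensity P F x) - Real.log (forestDensity Q F x)) =
      ∑ i, relEnt (nodeMarginal P i) (nodeMarginal Q i) + ∑ e ∈ F.edgeFinset, ∑ x,
        P.real {x} * (Real.log (edgeFactor P x e) - Real.log (edgeFactor Q x e)) := by
  have hnP := nodeMarginal_pos_of_pairMarginal_pos hd hr P hP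
  have hnQ := nodeMarginal_pos_of_pairMarginal_pos hd hr Q hQ
  have h2 : ∀ i, relEnt (nodeMarginal P i) (nodeMarginal Q i) = ∑ x, P.real {x} *
      (Real.log (nodeMarginal P i (x i)) - Real.log (nodeMarginal Q i (x i))) := by
    intro i
    rw [sum_mul_node P i (fun a => Real.log (nodeMarginal P i a) - Real.log (nodeMarginal Q i a)),
      relEnt]
    exact Finset.sum_congr rfl fun a _ => by rw [Real.log_div (hnP _ _).ne' (hnQ _ _).ne']
  simp only [h2]
  rw [Finset.sum_comm, Finset.sum_comm (s := F.edgeFinset), ← Finset.sum_add_distrib]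
  refine Finset.sum_congr rfl fun x _ => ?_
  rw [← Finset.mul_sum, ← Finset.mul_sum, ← mul_add,
    log_forestDensity P F (forestDensity_pos hd hr P hP F x),
    log_forestDensity Q F (forestDensity_pos hd hr Q hQ F x), Finset.sum_sub_distrib,
    Finset.sum_sub_distrib]
  ring

/-- Each non-isolated vertex has its N_i cancelled by an incident edge. What remains is at most B
per edge and B per isolated vertex, and these number at most |V| - 1. -/
theorem sum_sub_sum_edges_le {V : Type*} [Fintype V] [DecidableEq V] {F : SimpleGraph V}
    [Fintype F.edgeSet] (hF : F.IsAcyclic) (hne : F ≠ ⊥) {N : V → ℝ} {E : Sym2 V → ℝ} {B : ℝ}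
    (hN0 : ∀ i, 0 ≤ N i) (hN : ∀ i, N i ≤ B)
    (hE : ∀ i j, F.Adj i j → E s(i, j) ≤ B - N i - N j) :
    ∑ i, N i + ∑ e ∈ F.edgeFinset, E e ≤ (Fintype.card V - 1) * B := by
  classical
  have hB : 0 ≤ B := by
    obtain ⟨a, -⟩ := SimpleGraph.ne_bot_iff_exists_adj.mp hne
    exact (hN0 a).trans (hN a)
  have h1 : ∀ e ∈ F.edgeFinset, E e ≤ B - ∑ i, if i ∈ e then N i else 0 := by
    intro e he
    induction e with
    | _ i j =>
      have hij : F.Adj i j := by simpa using he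
      have h2 : ∑ k, (if k ∈ s(i, j) then N k else 0) = N i + N j := by
        rw [← Finset.sum_filter, ← Finset.sum_pair hij.ne]
        congr 1
        ext k
        simp
      rw [h2]
      linarith [hE i j hij]
  have h3 := Finset.sum_le_sum h1
  rw [Finset.sum_sub_distrib, Finset.sum_const, nsmul_eq_mul, Finset.sum_comm] at h3
  have h4 : ∑ i, N i ≤ ∑ i, (∑ e ∈ F.edgeFinset, if i ∈ e then N i else 0) +
      ({v | ∀ w, ¬ F.Adj v w}.ncard : ℝ) * B := by
    have h5 : ({v | ∀ w, ¬ F.Adj v w}.ncard : ℝ) * B =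
        ∑ i, if ∀ w, ¬ F.Adj i w then B else 0 := by
      rw [← Finset.sum_filter, Finset.sum_const, nsmul_eq_mul, Set.ncard_eq_toFinset_card',
        Set.toFinset_ofPred]
    rw [h5, ← Finset.sum_add_distrib]
    refine Finset.sum_le_sum fun i _ => ?_
    have hnn : ∀ e ∈ F.edgeFinset, 0 ≤ if i ∈ e then N i else 0 := by
      intro e _
      split_ifs
      exacts [hN0 i, le_rfl]
    by_cases hi : ∀ w, ¬ F.Adj i w
    · rw [if_pos hi]
      exact (hN i).trans (le_add_of_nonneg_left (Finset.sum_nonneg hnn))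
    · rw [if_neg hi, add_zero]
      push Not at hi
      obtain ⟨w, hw⟩ := hi
      have := Finset.single_le_sum hnn (by simpa using hw : s(i, w) ∈ F.edgeFinset)
      simpa using this
  have h6 := ncard_edgeSet_add_ncard_isolated hF hne
  rw [Nat.card_eq_fintype_card, ← SimpleGraph.coe_edgeFinset, Set.ncard_coe_finset] at h6
  have h7 : (F.edgeFinset.card : ℝ) + ({v | ∀ w, ¬ F.Adj v w}.ncard : ℝ) ≤
      Fintype.card V - 1 := by
    rw [le_sub_iff_add_le]
    exact_mod_cast h6
  have h8 := mul_le_mul_of_nonneg_right h7 hB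
  linarith

/-- Counterpart for the empty forest: two nodes sharing one budget B save the unit that an edge
would have saved. -/
theorem sum_le_of_add_le {V : Type*} [Fintype V] {N : V → ℝ} {B : ℝ}
    (hN : ∀ i, N i ≤ B) {i j : V} (hij : i ≠ j) (hB : N i + N j ≤ B) :
    ∑ i, N i ≤ (Fintype.card V - 1) * B := by
  classical
  rw [← Finset.add_sum_erase _ _ (Finset.mem_univ i),
    ← Finset.add_sum_erase (Finset.univ.erase i) _ (Finset.mem_erase.mpr ⟨hij.symm,
      Finset.mem_univ j⟩)]
  have h1 := Finset.sum_le_card_nsmul ((Finset.univ.erase i).erase j) N B fun k _ => hN k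
  have h2 : ((Finset.univ.erase i).erase j).card + 2 = Fintype.card V := by
    rw [← Finset.card_univ, ← Finset.card_erase_add_one (Finset.mem_univ i),
      ← Finset.card_erase_add_one (s := Finset.univ.erase i) (Finset.mem_erase.mpr ⟨hij.symm,
      Finset.mem_univ j⟩)]
  have h3 : (((Finset.univ.erase i).erase j).card : ℝ) = Fintype.card V - 2 := by
    rw [← h2]; push_cast; ring
  rw [nsmul_eq_mul, h3] at h1
  linarith

/-- Zero information makes P_ij a product, and then the pair divergence is the sum of the node
divergences plus the mutual information of Q_ij. -/
theorem relEnt_node_add_le (hd : 2 ≤ d) (hr : 0 < r) {P Q : Measure (Fin d → Fin r)}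
    [IsProbabilityMeasure P] [IsProbabilityMeasure Q]
    (hP : ∀ i j : Fin d, i ≠ j → ∀ a b : Fin r, 0 < pairMarginal P i j a b)
    (hQ : ∀ i j : Fin d, i ≠ j → ∀ a b : Fin r, 0 < pairMarginal Q i j a b)
    {i j : Fin d} (hij : i ≠ j) (h0 : mutualInfo P i j = 0) :
    relEnt (nodeMarginal Q i) (nodeMarginal P i) + relEnt (nodeMarginal Q j) (nodeMarginal P j) ≤
      relEnt (pairLaw Q i j) (pairLaw P i j) := by
  have hnP := nodeMarginal_pos_of_pairMarginal_pos hd hr P hP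
  have hnQ := nodeMarginal_pos_of_pairMarginal_pos hd hr Q hQ
  have hprod : ∀ a b, pairMarginal P i j a b = nodeMarginal P i a * nodeMarginal P j b := by
    intro a b
    rw [← relEnt_pair_product] at h0
    have hsum := (sum_prod_pairMarginal P i j).trans (sum_prod_nodeMarginal_mul P i j).symm
    have h := eq_of_relEnt_eq_zero (fun p => pairMarginal_nonneg P i j p.1 p.2)
      (fun p => mul_pos (hnP i p.1) (hnP j p.2)) hsum h0 (a, b)
    exact h
  have h1 := sum_mul_log_edgeFactor_sub hd hr hQ hP hij
  simp only [mul_sub, Finset.sum_sub_distrib, sum_mul_log_edgeFactor] at h1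
  have h2 : ∀ x, edgeFactor P x s(i, j) = 1 := by
    intro x
    rw [edgeFactor_mk, hprod, div_self (mul_pos (hnP _ _) (hnP _ _)).ne']
  have h3 := edgeInfo_nonneg Q hnQ s(i, j)
  simp only [h2, Real.log_one, mul_zero, Finset.sum_const_zero, sub_zero] at h1
  linarith

theorem risk_le_of_relEnt_le (hd : 2 ≤ d) (hr : 0 < r) {P Ptilde Q : Measure (Fin d → Fin r)}
    [IsProbabilityMeasure P] [IsProbabilityMeasure Q]
    (hP : ∀ i j : Fin d, i ≠ j → ∀ a b : Fin r, 0 < pairMarginal P i j a b)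
    (hQ : ∀ i j : Fin d, i ≠ j → ∀ a b : Fin r, 0 < pairMarginal Q i j a b)
    (hPt : IsForestStructured Ptilde) {F : SimpleGraph (Fin d)} (hF : F.IsAcyclic)
    (hmax : ∀ T : SimpleGraph (Fin d), T.IsTree → weight P T ≤ weight P F)
    (hbot : F = ⊥ → ∃ i j, i ≠ j ∧ mutualInfo P i j = 0) {δ : ℝ}
    (hclose : ∀ i j, i ≠ j → ∀ a b,
      (1 - 1 / (d : ℝ)) * pairMarginal P i j a b ≤ pairMarginal Q i j a b)
    (hpair : ∀ i j, i ≠ j → relEnt (pairLaw Q i j) (pairLaw P i j) ≤ δ)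
    (hnode : ∀ i, relEnt (nodeMarginal Q i) (nodeMarginal P i) ≤ δ) :
    risk P Ptilde (forestLaw Q F) ≤ ((d * δ : ℝ) : EReal) := by
  classical
  refine (risk_le_sum hd hr hP hQ hPt hF hmax).trans (EReal.coe_le_coe_iff.mpr ?_)
  have hnP := nodeMarginal_pos_of_pairMarginal_pos hd hr P hP
  have hnQ := nodeMarginal_pos_of_pairMarginal_pos hd hr Q hQ
  have hd' : (2 : ℝ) ≤ d := by exact_mod_cast hd
  have hd1 : (0 : ℝ) < d - 1 := by linarith
  -- The inverse of 1 - 1/d: closeness gives P ≤ cQ on marginals, hence reversal of divergences at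
  -- cost c, and (d-1)c = d makes the final bound exactly dδ.
  set c : ℝ := d / (d - 1) with hc
  have hc1 : 1 ≤ c := by rw [hc, le_div_iff₀ hd1]; linarith
  have hcc : c * (1 - 1 / (d : ℝ)) = 1 := by
    rw [hc]; field_simp
  have hpc : ∀ i j, i ≠ j → ∀ a b, pairMarginal P i j a b ≤ c * pairMarginal Q i j a b := by
    intro i j hij a b
    have := mul_le_mul_of_nonneg_left (hclose i j hij a b) (by linarith : 0 ≤ c)
    rwa [← mul_assoc, hcc, one_mul] at this
  have hnc : ∀ i a, nodeMarginal P i a ≤ c * nodeMarginal Q i a := by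
    intro i a
    have : Nontrivial (Fin d) := Fin.nontrivial_iff_two_le.mpr hd
    obtain ⟨j, hj⟩ := exists_ne i
    rw [← sum_pairMarginal_right P i j, ← sum_pairMarginal_right Q i j, Finset.mul_sum]
    exact Finset.sum_le_sum fun b _ => hpc i j hj.symm a b
  have hsumN : ∀ i, ∑ a, nodeMarginal P i a = ∑ a, nodeMarginal Q i a := fun i => by
    rw [sum_nodeMarginal, sum_nodeMarginal]
  have hNrev : ∀ i, relEnt (nodeMarginal P i) (nodeMarginal Q i) ≤
      c * relEnt (nodeMarginal Q i) (nodeMarginal P i) := fun i =>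
    relEnt_le_mul_relEnt (hnP i) (hnQ i) (hsumN i) hc1 (hnc i)
  have hc0 : 0 ≤ c := by linarith
  have hN : ∀ i, relEnt (nodeMarginal P i) (nodeMarginal Q i) ≤ c * δ := fun i =>
    (hNrev i).trans (mul_le_mul_of_nonneg_left (hnode i) hc0)
  have hN0 : ∀ i, 0 ≤ relEnt (nodeMarginal P i) (nodeMarginal Q i) := fun i =>
    relEnt_nonneg (fun a => (hnP i a).le) (hnQ i) (hsumN i)
  have hgoal : (d : ℝ) * δ = ((Fintype.card (Fin d) : ℝ) - 1) * (c * δ) := by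
    rw [Fintype.card_fin, hc]; field_simp
  rw [sum_mul_log_forestDensity_sub hd hr hP hQ, hgoal]
  by_cases hFbot : F = ⊥
  · obtain ⟨i, j, hij, hij0⟩ := hbot hFbot
    have hempty : F.edgeFinset = ∅ := by
      rw [SimpleGraph.edgeFinset_eq_empty]; exact hFbot
    rw [hempty, Finset.sum_empty, add_zero]
    refine sum_le_of_add_le hN hij ((add_le_add (hNrev i) (hNrev j)).trans ?_)
    rw [← mul_add]
    exact mul_le_mul_of_nonneg_left
      ((relEnt_node_add_le hd hr hP hQ hij hij0).trans (hpair i j hij)) hc0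
  · refine sum_sub_sum_edges_le hF hFbot hN0 hN fun i j hij => ?_
    rw [sum_mul_log_edgeFactor_sub hd hr hP hQ hij.ne]
    have h1 : relEnt (pairLaw P i j) (pairLaw Q i j) ≤
        c * relEnt (pairLaw Q i j) (pairLaw P i j) :=
      relEnt_le_mul_relEnt (p := pairLaw P i j) (q := pairLaw Q i j)
        (fun p => hP i j hij.ne p.1 p.2) (fun p => hQ i j hij.ne p.1 p.2)
        ((sum_pairLaw P i j).trans (sum_pairLaw Q i j).symm) hc1
        (fun p => hpc i j hij.ne p.1 p.2)
    have h2 := mul_le_mul_of_nonneg_left (hpair i j hij.ne) hc0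
    linarith

/-! ### Stability of the output forest near `P` -/

/-- Mutual information of a mass function on pairs, with the marginals computed from it. -/
def mutualInfoOf (m : Fin r → Fin r → ℝ) : ℝ :=
  ∑ a, ∑ b, m a b * Real.log (m a b / ((∑ b', m a b') * ∑ a', m a' b))

theorem mutualInfoOf_pairMarginal (μ : Measure (Fin d → Fin r)) [IsFiniteMeasure μ] (i j : Fin d) :
    mutualInfoOf (pairMarginal μ i j) = mutualInfo μ i j := by
  simp only [mutualInfoOf, mutualInfo, sum_pairMarginal_left, sum_pairMarginal_right]

theorem continuousAt_mutualInfoOf {m : Fin r → Fin r → ℝ} (hm : ∀ a b, 0 < m a b) :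
    ContinuousAt mutualInfoOf m := by
  unfold mutualInfoOf
  refine tendsto_finsetSum _ fun a _ => tendsto_finsetSum _ fun b _ => ?_
  have h1 : 0 < ∑ b', m a b' := Finset.sum_pos (fun b' _ => hm a b') ⟨b, Finset.mem_univ b⟩
  have h2 : 0 < ∑ a', m a' b := Finset.sum_pos (fun a' _ => hm a' b) ⟨a, Finset.mem_univ a⟩
  have c1 : ContinuousAt (fun m : Fin r → Fin r → ℝ => m a b) m :=
    (continuous_apply_apply a b).continuousAt
  have c2 : ContinuousAt (fun m : Fin r → Fin r → ℝ => (∑ b', m a b') * ∑ a', m a' b) m := by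
    fun_prop
  exact c1.mul ((c1.div c2 (mul_pos h1 h2).ne').log (div_pos (hm a b) (mul_pos h1 h2)).ne')

/-- Both conclusions are continuous in the square roots of the pair masses, and a divergence of at
most δ moves each square root by at most √δ. -/
theorem eventually_relEnt_close (P : Measure (Fin d → Fin r)) [IsProbabilityMeasure P]
    {i j : Fin d} (hP : ∀ a b : Fin r, 0 < pairMarginal P i j a b) {γ c : ℝ} (hγ : 0 < γ)
    (hc : c < 1) :
    ∀ᶠ δ in 𝓝[>] (0 : ℝ), ∀ (Q : Measure (Fin d → Fin r)) [IsProbabilityMeasure Q],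
      relEnt (pairLaw Q i j) (pairLaw P i j) ≤ δ →
        |mutualInfo Q i j - mutualInfo P i j| < γ ∧
          ∀ a b, c * pairMarginal P i j a b < pairMarginal Q i j a b := by
  have hsq : ContinuousAt (fun s : Fin r → Fin r → ℝ => fun a b => s a b ^ 2)
      (fun a b => √(pairMarginal P i j a b)) :=
    (continuous_pi fun a => continuous_pi fun b =>
      (continuous_apply_apply a b).pow 2).continuousAt
  have hval : (fun a b => √(pairMarginal P i j a b) ^ 2) = pairMarginal P i j := by
    funext a b
    exact Real.sq_sqrt (hP a b).le
  have hMI : Tendsto (fun s : Fin r → Fin r → ℝ => mutualInfoOf (fun a b => s a b ^ 2))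
      (𝓝 (fun a b => √(pairMarginal P i j a b))) (𝓝 (mutualInfo P i j)) := by
    rw [← mutualInfoOf_pairMarginal]
    have h1 := continuousAt_mutualInfoOf hP
    rw [ContinuousAt] at hsq h1
    simp only [hval] at hsq
    exact h1.comp hsq
  have e1 := hMI.eventually (Metric.ball_mem_nhds _ hγ)
  have e2 : ∀ a b, ∀ᶠ s : Fin r → Fin r → ℝ in 𝓝 (fun a b => √(pairMarginal P i j a b)),
      c * pairMarginal P i j a b < s a b ^ 2 := by
    intro a b
    have h2 : ContinuousAt (fun s : Fin r → Fin r → ℝ => s a b ^ 2)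
        (fun a b => √(pairMarginal P i j a b)) :=
      ((continuous_apply_apply a b).pow 2).continuousAt
    refine h2.eventually_const_lt ?_
    beta_reduce
    rw [Real.sq_sqrt (hP a b).le]
    nlinarith [hP a b]
  obtain ⟨ρ, hρ, hball⟩ := Metric.eventually_nhds_iff.mp
    (e1.and (eventually_all.mpr fun a => eventually_all.mpr (e2 a)))
  have hlt : ∀ᶠ δ in 𝓝[>] (0 : ℝ), δ < ρ ^ 2 :=
    (eventually_lt_nhds (by positivity)).filter_mono nhdsWithin_le_nhds
  filter_upwards [hlt] with δ hδ Q _ hQ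
  have hdist : dist (fun a b => √(pairMarginal Q i j a b))
      (fun a b => √(pairMarginal P i j a b)) < ρ := by
    refine (dist_pi_lt_iff hρ).mpr fun a => (dist_pi_lt_iff hρ).mpr fun b => ?_
    rw [Real.dist_eq]
    refine abs_lt_of_sq_lt_sq ?_ hρ.le
    refine lt_of_le_of_lt ?_ hδ
    refine le_trans ?_ hQ
    have h := sq_sqrt_sub_sqrt_le_relEnt (p := pairLaw Q i j) (q := pairLaw P i j)
      (fun p => pairMarginal_nonneg Q i j p.1 p.2) (fun p => hP p.1 p.2)
      ((sum_pairLaw Q i j).trans (sum_pairLaw P i j).symm) (a, b)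
    exact h
  obtain ⟨h1, h2⟩ := hball hdist
  have hvalQ : (fun a b => √(pairMarginal Q i j a b) ^ 2) = pairMarginal Q i j := by
    funext a b
    exact Real.sq_sqrt (pairMarginal_nonneg Q i j a b)
  refine ⟨?_, fun a b => ?_⟩
  · rw [hvalQ, mutualInfoOf_pairMarginal] at h1
    exact h1
  · have := h2 a b
    rwa [Real.sq_sqrt (pairMarginal_nonneg Q i j a b)] at this

/-- Strict comparisons of edge weights survive small perturbations of the off-diagonal weights. -/
theorem exists_perturbation_radius {V : Type*} [Fintype V] [DecidableEq V] (w₀ : Sym2 V → ℝ) :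
    ∃ γ : ℝ, 0 < γ ∧ ∀ w : Sym2 V → ℝ, (∀ e, ¬ e.IsDiag → |w e - w₀ e| < γ) →
      (∀ S T : Finset (Sym2 V), (∀ e ∈ S, ¬ e.IsDiag) → (∀ e ∈ T, ¬ e.IsDiag) →
        ∑ e ∈ S, w₀ e < ∑ e ∈ T, w₀ e → ∑ e ∈ S, w e < ∑ e ∈ T, w e) ∧
      ∀ e, ¬ e.IsDiag → 0 < w₀ e → γ < w e := by
  have e1 : ∀ᶠ w in 𝓝 w₀, ∀ S T : Finset (Sym2 V),
      ∑ e ∈ S, w₀ e < ∑ e ∈ T, w₀ e → ∑ e ∈ S, w e < ∑ e ∈ T, w e := by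
    refine eventually_all.mpr fun S => eventually_all.mpr fun T => ?_
    by_cases h : ∑ e ∈ S, w₀ e < ∑ e ∈ T, w₀ e
    · have hS : ContinuousAt (fun w : Sym2 V → ℝ => ∑ e ∈ S, w e) w₀ := by fun_prop
      have hT : ContinuousAt (fun w : Sym2 V → ℝ => ∑ e ∈ T, w e) w₀ := by fun_prop
      filter_upwards [hS.eventually_lt hT h] with w hw _ using hw
    · exact Eventually.of_forall fun w hw => (h hw).elim
  obtain ⟨ρ, hρ, hball⟩ := Metric.eventually_nhds_iff.mp e1
  -- A positive weight exceeds 2γ, so after a perturbation smaller than γ it still exceeds γ, which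
  -- serves as threshold.
  have e2 : ∀ᶠ γ in 𝓝[>] (0 : ℝ), ∀ e, 0 < w₀ e → γ + γ < w₀ e := by
    refine eventually_all.mpr fun e => ?_
    by_cases h : 0 < w₀ e
    · have : ContinuousAt (fun γ : ℝ => γ + γ) 0 := by fun_prop
      filter_upwards [(this.eventually_lt_const (by simpa using h)).filter_mono
        nhdsWithin_le_nhds] with γ hγ _ using hγ
    · exact Eventually.of_forall fun w hw => (h hw).elim
  have e3 : ∀ᶠ γ in 𝓝[>] (0 : ℝ), γ < ρ :=
    (eventually_lt_nhds hρ).filter_mono nhdsWithin_le_nhds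
  obtain ⟨γ, ⟨h2, h3⟩, hγ⟩ := ((e2.and e3).and self_mem_nhdsWithin).exists
  refine ⟨γ, hγ, fun w hw => ⟨fun S T hS hT hST => ?_, fun e he h0 => ?_⟩⟩
  · classical
    -- Diagonal weights are not controlled, so they are reset to `w₀`; the sums compared do not
    -- involve them.
    have hdist : dist (fun e => if e.IsDiag then w₀ e else w e) w₀ < ρ := by
      refine (dist_pi_lt_iff hρ).mpr fun e => ?_
      split_ifs with h
      · simpa using hρ
      · exact (hw e h).trans h3
    have h := hball hdist S T hST
    rwa [Finset.sum_congr rfl fun e he => if_neg (hS e he),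
      Finset.sum_congr rfl fun e he => if_neg (hT e he)] at h
  · have h4 := abs_lt.mp (hw e he)
    have h5 := h2 e h0
    linarith [h4.1]

theorem IsOutput.isAcyclic {ε : ℝ} {μ : Measure (Fin d → Fin r)} {F : SimpleGraph (Fin d)}
    (h : IsOutput ε μ F) : F.IsAcyclic := by
  obtain ⟨T, hT, e, -, he, -, k, -, -, -, rfl⟩ := h
  refine hT.1.isAcyclic.anti ?_
  rw [← SimpleGraph.fromEdgeSet_edgeSet T, ← he]
  exact SimpleGraph.fromEdgeSet_mono (Set.image_subset_range _ _)

theorem IsOutput.exists_tree {ε : ℝ} {μ : Measure (Fin d → Fin r)} {F : SimpleGraph (Fin d)}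
    (h : IsOutput ε μ F) : ∃ T, IsMaxWeightTree μ T ∧ F ≤ T ∧
      ∀ e ∈ T.edgeSet, e ∉ F.edgeSet → edgeInfo μ e ≤ ε := by
  obtain ⟨T, hT, e, -, he, -, k, -, -, hlow, rfl⟩ := h
  refine ⟨T, hT, ?_, fun f hf hfF => ?_⟩
  · rw [← SimpleGraph.fromEdgeSet_edgeSet T, ← he]
    exact SimpleGraph.fromEdgeSet_mono (Set.image_subset_range _ _)
  · have hf' := hf
    rw [← he] at hf'
    obtain ⟨j, rfl⟩ := hf'
    refine hlow j (le_of_not_gt fun hj => hfF ?_)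
    rw [SimpleGraph.edgeSet_fromEdgeSet]
    exact ⟨⟨j, hj, rfl⟩, T.not_isDiag_of_mem_edgeSet hf⟩

/-- A maximal tree for `Q` is maximal for `P`, since a strict advantage of another tree under `P`
would persist under `Q`. Discarded edges have zero information under `P`, so `F` keeps the full
weight. Superfluous edges of zero information may be kept; they do not spoil maximality. -/
theorem exists_risk_bound (hd : 2 ≤ d) (hr : 0 < r) {P Ptilde : Measure (Fin d → Fin r)}
    [IsProbabilityMeasure P]
    (hP : ∀ i j : Fin d, i ≠ j → ∀ a b : Fin r, 0 < pairMarginal P i j a b)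
    (hPt : IsForestStructured Ptilde) :
    ∃ δ₀ : ℝ, 0 < δ₀ ∧ ∃ ε₀ : ℝ, 0 < ε₀ ∧
      ∀ (Q : Measure (Fin d → Fin r)) [IsProbabilityMeasure Q] (F : SimpleGraph (Fin d))
        (ε δ : ℝ), IsOutput ε Q F → ε ≤ ε₀ → δ ≤ δ₀ →
        (∀ i j, i ≠ j → relEnt (pairLaw Q i j) (pairLaw P i j) ≤ δ) →
        (∀ i, relEnt (nodeMarginal Q i) (nodeMarginal P i) ≤ δ) →
        risk P Ptilde (forestLaw Q F) ≤ ((d * δ : ℝ) : EReal) := by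
  classical
  obtain ⟨γ, hγ, hpert⟩ := exists_perturbation_radius (edgeInfo P)
  have hd' : (2 : ℝ) ≤ d := by exact_mod_cast hd
  have hc : 1 - 1 / (d : ℝ) < 1 := by
    have : 0 < 1 / (d : ℝ) := by positivity
    linarith
  have hc0 : 0 ≤ 1 - 1 / (d : ℝ) := by
    rw [sub_nonneg, div_le_one (by linarith)]; linarith
  have hev : ∀ᶠ δ in 𝓝[>] (0 : ℝ), ∀ i j, i ≠ j →
      ∀ (Q : Measure (Fin d → Fin r)) [IsProbabilityMeasure Q],
      relEnt (pairLaw Q i j) (pairLaw P i j) ≤ δ →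
        |mutualInfo Q i j - mutualInfo P i j| < γ ∧
          ∀ a b, (1 - 1 / (d : ℝ)) * pairMarginal P i j a b < pairMarginal Q i j a b := by
    refine eventually_all.mpr fun i => eventually_all.mpr fun j => ?_
    by_cases hij : i = j
    · exact Eventually.of_forall fun δ h => (h hij).elim
    · filter_upwards [eventually_relEnt_close P (hP i j hij) hγ hc] with δ hδ _ using hδ
  obtain ⟨δ₀, hδ₀, hδ₀pos⟩ := (hev.and self_mem_nhdsWithin).exists
  refine ⟨δ₀, hδ₀pos, γ, hγ, fun Q _ F ε δ hout hε hδ hpair hnode => ?_⟩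
  have hnP := nodeMarginal_pos_of_pairMarginal_pos hd hr P hP
  have hclose := fun i j hij => hδ₀ i j hij Q ((hpair i j hij).trans hδ)
  have hQ : ∀ i j : Fin d, i ≠ j → ∀ a b : Fin r, 0 < pairMarginal Q i j a b :=
    fun i j hij a b => lt_of_le_of_lt (mul_nonneg hc0 (hP i j hij a b).le)
      ((hclose i j hij).2 a b)
  have hedge : ∀ e : Sym2 (Fin d), ¬ e.IsDiag → |edgeInfo Q e - edgeInfo P e| < γ := by
    intro e he
    induction e with
    | _ i j => exact (hclose i j (by simpa using he)).1
  obtain ⟨hcmp, hthr⟩ := hpert (edgeInfo Q) hedge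
  have hF := hout.isAcyclic
  obtain ⟨T, hT, hFT, hdrop⟩ := hout.exists_tree
  have hzero : ∀ e ∈ T.edgeSet, e ∉ F.edgeSet → edgeInfo P e = 0 := by
    intro e he heF
    refine le_antisymm (le_of_not_gt fun h0 => ?_) (edgeInfo_nonneg P hnP e)
    have h1 := hthr e (T.not_isDiag_of_mem_edgeSet he) h0
    have h2 := hdrop e he heF
    linarith
  have hw : weight P F = weight P T := by
    unfold weight
    refine Finset.sum_subset (SimpleGraph.edgeFinset_mono hFT) fun e he heF => hzero e ?_ ?_
    · simpa using he
    · simpa using heF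
  have hmax : ∀ T' : SimpleGraph (Fin d), T'.IsTree → weight P T' ≤ weight P F := by
    intro T' hT'
    rw [hw]
    by_contra hlt
    have h1 := hT.2 T' hT'
    refine absurd (hcmp T.edgeFinset T'.edgeFinset (fun e he => ?_) (fun e he => ?_)
      (not_le.mp hlt)) (not_lt.mpr h1)
    · exact T.not_isDiag_of_mem_edgeSet (by simpa using he)
    · exact T'.not_isDiag_of_mem_edgeSet (by simpa using he)
  refine risk_le_of_relEnt_le hd hr hP hQ hPt hF hmax (fun hbot => ?_)
    (fun i j hij a b => ((hclose i j hij).2 a b).le) hpair hnode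
  -- If nothing is kept, the tree edge at vertex 0 was discarded and supplies the pair with zero
  -- information.
  have : Nontrivial (Fin d) := Fin.nontrivial_iff_two_le.mpr hd
  obtain ⟨j, hij⟩ := hT.1.connected.preconnected.exists_adj_of_nontrivial (⟨0, by omega⟩ : Fin d)
  exact ⟨_, j, hij.ne, hzero s(_, j) hij (by simp [hbot])⟩

/-! ### Method of types -/

/-- Relative frequencies of the letters of a word. -/
def wordType {A : Type*} [DecidableEq A] {n : ℕ} (y : Fin n → A) (a : A) : ℝ :=
  (Finset.univ.filter fun l => y l = a).card / n

theorem wordType_pos {A : Type*} [DecidableEq A] {n : ℕ} (y : Fin n → A) (l : Fin n) :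
    0 < wordType y (y l) := by
  have hn : 0 < n := l.pos
  refine div_pos (Nat.cast_pos.mpr (Finset.card_pos.mpr ⟨l, by simp⟩)) (by positivity)

section Word

variable {A : Type*} [DecidableEq A] [Fintype A] {n : ℕ}

theorem sum_wordType_mul (hn : 0 < n) (y : Fin n → A) (f : A → ℝ) :
    n * ∑ a, wordType y a * f a = ∑ l, f (y l) := by
  have hn' : (n : ℝ) ≠ 0 := by positivity
  rw [Finset.mul_sum, ← Finset.sum_fiberwise Finset.univ y]
  refine Finset.sum_congr rfl fun a _ => ?_
  rw [Finset.sum_congr rfl (g := fun _ => f a) fun l hl => by rw [(Finset.mem_filter.mp hl).2],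
    Finset.sum_const, nsmul_eq_mul, wordType]
  field_simp

theorem prod_eq_exp_mul_prod_wordType (hn : 0 < n) {p : A → ℝ} (hp : ∀ a, 0 < p a)
    (y : Fin n → A) :
    ∏ l, p (y l) = Real.exp (-(n * relEnt (wordType y) p)) * ∏ l, wordType y (y l) := by
  rw [relEnt, sum_wordType_mul hn y (fun a => Real.log (wordType y a / p a)),
    ← Finset.sum_neg_distrib, Real.exp_sum, ← Finset.prod_mul_distrib]
  refine Finset.prod_congr rfl fun l _ => ?_
  have h1 := wordType_pos y l
  rw [← Real.log_inv, inv_div, Real.exp_log (div_pos (hp _) h1), div_mul_cancel₀ _ h1.ne']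

/-- Words of one type have total mass at most 1 under the product of that type, and there are at
most (n+1)^|A| types. -/
theorem sum_prod_wordType_le (hn : 0 < n) :
    ∑ y : Fin n → A, ∏ l, wordType y (y l) ≤ ((n : ℝ) + 1) ^ Fintype.card A := by
  have hcount : ∀ (y : Fin n → A) (a : A),
      (Finset.univ.filter fun l => y l = a).card < n + 1 := fun y a =>
    Nat.lt_succ_of_le ((Finset.card_le_univ _).trans_eq (Fintype.card_fin n))
  rw [← Finset.sum_fiberwise Finset.univ
    (fun y : Fin n → A => fun a => (⟨_, hcount y a⟩ : Fin (n + 1)))]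
  have hle : ∀ c : A → Fin (n + 1), ∑ y : Fin n → A with
      (fun a => (⟨_, hcount y a⟩ : Fin (n + 1))) = c, ∏ l, wordType y (y l) ≤ 1 := by
    intro c
    by_cases hc : ∃ y : Fin n → A, (fun a => (⟨_, hcount y a⟩ : Fin (n + 1))) = c
    · obtain ⟨y₀, hy₀⟩ := hc
      have htype : ∀ y : Fin n → A, (fun a => (⟨_, hcount y a⟩ : Fin (n + 1))) = c →
          wordType y = wordType y₀ := by
        intro y hy
        funext a
        have h := congrArg Fin.val (congrFun (hy.trans hy₀.symm) a)
        simp only at h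
        rw [wordType, wordType, h]
      have hsum : ∑ a, wordType y₀ a = 1 := by
        have h := sum_wordType_mul hn y₀ (fun _ => 1)
        simp only [mul_one, Finset.sum_const, Finset.card_univ, Fintype.card_fin, nsmul_eq_mul] at h
        exact mul_left_cancel₀ (by positivity : (n : ℝ) ≠ 0) (h.trans (mul_one _).symm)
      calc _ = ∑ y : Fin n → A with (fun a => (⟨_, hcount y a⟩ : Fin (n + 1))) = c,
              ∏ l, wordType y₀ (y l) :=
            Finset.sum_congr rfl fun y hy => by rw [htype y (Finset.mem_filter.mp hy).2]
        _ ≤ ∑ y : Fin n → A, ∏ l, wordType y₀ (y l) :=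
            Finset.sum_le_sum_of_subset_of_nonneg (Finset.filter_subset _ _) fun y _ _ =>
              Finset.prod_nonneg fun l _ => by unfold wordType; positivity
        _ = 1 := by rw [← Fintype.sum_pow, hsum, one_pow]
    · rw [Finset.sum_eq_zero]
      · exact zero_le_one
      · exact fun y hy => (hc ⟨y, (Finset.mem_filter.mp hy).2⟩).elim
  refine (Finset.sum_le_sum fun c _ => hle c).trans (le_of_eq ?_)
  simp

end Word

theorem pi_real_word {Ω A : Type*} [Finite Ω] [MeasurableSpace Ω] [MeasurableSingletonClass Ω]
    (P : Measure Ω) [IsProbabilityMeasure P] {n : ℕ} (φ : Ω → A) (y : Fin n → A) :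
    (Measure.pi fun _ : Fin n => P).real {xs | ∀ l, φ (xs l) = y l} =
      ∏ l, P.real {x | φ x = y l} := by
  have h : {xs : Fin n → Ω | ∀ l, φ (xs l) = y l} =
      Set.univ.pi fun l => {x | φ x = y l} := by
    ext xs
    simp
  rw [h, measureReal_def, Measure.pi_pi, ENNReal.toReal_prod]
  rfl

/-- Upper bound in Sanov's theorem, by the method of types. -/
theorem pi_real_relEnt_ge_le {Ω A : Type*} [Finite Ω] [MeasurableSpace Ω]
    [MeasurableSingletonClass Ω] [Fintype A] [DecidableEq A]
    (P : Measure Ω) [IsProbabilityMeasure P] {n : ℕ} (hn : 0 < n) (φ : Ω → A)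
    (hp : ∀ a, 0 < P.real {x | φ x = a}) (δ : ℝ) :
    (Measure.pi fun _ : Fin n => P).real
      {xs | δ ≤ relEnt (wordType fun l => φ (xs l)) (fun a => P.real {x | φ x = a})} ≤
      ((n : ℝ) + 1) ^ Fintype.card A * Real.exp (-(n * δ)) := by
  classical
  set p : A → ℝ := fun a => P.real {x | φ x = a} with hpdef
  have h1 := sum_measureReal_preimage_singleton (μ := Measure.pi fun _ : Fin n => P)
    (f := fun (xs : Fin n → Ω) (l : Fin n) => φ (xs l))
    (Finset.univ.filter fun y : Fin n → A => δ ≤ relEnt (wordType y) p)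
    (fun y _ => (Set.toFinite _).measurableSet)
  have h2 : {xs : Fin n → Ω | δ ≤ relEnt (wordType fun l => φ (xs l)) p} =
      (fun (xs : Fin n → Ω) (l : Fin n) => φ (xs l)) ⁻¹'
        ↑(Finset.univ.filter fun y : Fin n → A => δ ≤ relEnt (wordType y) p) := by
    ext xs
    simp
  rw [h2, ← h1]
  have h3 : ∀ y : Fin n → A, (Measure.pi fun _ : Fin n => P).real
      ((fun (xs : Fin n → Ω) (l : Fin n) => φ (xs l)) ⁻¹' {y}) = ∏ l, p (y l) := by
    intro y
    rw [← pi_real_word P φ y]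
    congr 1
    ext xs
    simp [funext_iff]
  simp only [h3]
  have hpos : ∀ y : Fin n → A, 0 ≤ ∏ l, wordType y (y l) := fun y =>
    Finset.prod_nonneg fun l _ => (wordType_pos y l).le
  calc ∑ y : Fin n → A with δ ≤ relEnt (wordType y) p, ∏ l, p (y l)
      ≤ ∑ y : Fin n → A with δ ≤ relEnt (wordType y) p,
          (∏ l, wordType y (y l)) * Real.exp (-(n * δ)) := by
        refine Finset.sum_le_sum fun y hy => ?_
        rw [prod_eq_exp_mul_prod_wordType hn hp, mul_comm]
        refine mul_le_mul_of_nonneg_left (Real.exp_le_exp.mpr (neg_le_neg ?_)) (hpos y)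
        exact mul_le_mul_of_nonneg_left (Finset.mem_filter.mp hy).2 (Nat.cast_nonneg n)
    _ ≤ ∑ y : Fin n → A, (∏ l, wordType y (y l)) * Real.exp (-(n * δ)) :=
        Finset.sum_le_sum_of_subset_of_nonneg (Finset.filter_subset _ _) fun y _ _ =>
          mul_nonneg (hpos y) (Real.exp_pos _).le
    _ ≤ _ := by
        rw [← Finset.sum_mul]
        exact mul_le_mul_of_nonneg_right (sum_prod_wordType_le hn) (Real.exp_pos _).le

theorem isProbabilityMeasure_empirical {n : ℕ} (hn : 0 < n) (xs : Fin n → Fin d → Fin r) :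
    IsProbabilityMeasure (empirical xs) := by
  constructor
  have hn' : (n : ENNReal) ≠ 0 := by exact_mod_cast hn.ne'
  simp [empirical, Measure.finsetSum_apply, ENNReal.inv_mul_cancel hn']

theorem empirical_real {A : Type*} [DecidableEq A] {n : ℕ} (xs : Fin n → Fin d → Fin r)
    (φ : (Fin d → Fin r) → A) (a : A) :
    (empirical xs).real {x | φ x = a} = wordType (fun l => φ (xs l)) a := by
  rw [measureReal_def, empirical, wordType]
  simp [Measure.finsetSum_apply, Set.indicator_apply, ENNReal.toReal_mul,
    div_eq_inv_mul]

theorem nodeMarginal_empirical {n : ℕ} (xs : Fin n → Fin d → Fin r) (i : Fin d) :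
    nodeMarginal (empirical xs) i = wordType fun l => xs l i :=
  funext fun a => empirical_real xs (fun x => x i) a

theorem pairLaw_eq (μ : Measure (Fin d → Fin r)) (i j : Fin d) :
    pairLaw μ i j = fun p => μ.real {x | (x i, x j) = p} := by
  funext p
  simp only [pairLaw, pairMarginal, Prod.ext_iff]

theorem pairLaw_empirical {n : ℕ} (xs : Fin n → Fin d → Fin r) (i j : Fin d) :
    pairLaw (empirical xs) i j = wordType fun l => (xs l i, xs l j) := by
  rw [pairLaw_eq]
  exact funext fun p => empirical_real xs (fun x => (x i, x j)) p

/-! ### Lower bound for binomial probabilities -/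

theorem log_factorial_le {n : ℕ} (hn : 0 < n) :
    Real.log (n.factorial) ≤ n * Real.log n - n + Real.log n + 1 := by
  obtain ⟨m, rfl⟩ := Nat.exists_eq_succ_of_ne_zero hn.ne'
  have h1 := Stirling.log_stirlingSeq'_antitone (Nat.zero_le m)
  simp only [Function.comp_apply, Stirling.log_stirlingSeq_formula] at h1
  have hm : (0 : ℝ) < (m.succ : ℕ) := by positivity
  have hm1 : (1 : ℝ) ≤ (m.succ : ℕ) := by exact_mod_cast Nat.succ_le_succ (Nat.zero_le m)
  rw [Real.log_div hm.ne' (Real.exp_pos 1).ne', Real.log_exp,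
    Real.log_mul two_ne_zero hm.ne'] at h1
  simp at h1
  have h2 := Real.log_nonneg hm1
  push_cast at h2 ⊢
  linarith

theorem le_log_factorial {n : ℕ} (hn : 0 < n) :
    n * Real.log n - n ≤ Real.log (n.factorial) := by
  have h := Stirling.le_log_factorial_stirling hn.ne'
  have h1 : 0 ≤ Real.log n := Real.log_nonneg (by exact_mod_cast hn)
  have h2 : 0 ≤ Real.log (2 * Real.pi) := Real.log_nonneg (by linarith [Real.pi_gt_three])
  linarith

theorem exp_neg_binKL_le_binomial {n k : ℕ} (hk : 0 < k) (hkn : k < n) {s : ℝ} (hs0 : 0 < s)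
    (hs : s < 1) :
    Real.exp (n * (-binKL (k / n) s - (2 * Real.log n + 2) / n)) ≤
      n.choose k * (s ^ k * (1 - s) ^ (n - k)) := by
  obtain ⟨m, rfl⟩ := Nat.exists_eq_add_of_le hkn.le
  have hm : 0 < m := by omega
  have hn : 0 < k + m := by omega
  have hk' : (0 : ℝ) < k := by exact_mod_cast hk
  have hm' : (0 : ℝ) < m := by exact_mod_cast hm
  have hn' : (0 : ℝ) < ((k + m : ℕ) : ℝ) := by exact_mod_cast hn
  have h1s : 0 < 1 - s := by linarith
  have hchoose : (0 : ℝ) < ((k + m).choose k : ℝ) := by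
    exact_mod_cast Nat.choose_pos (Nat.le_add_right k m)
  rw [add_tsub_cancel_left, ← Real.le_log_iff_exp_le (by positivity)]
  have hfac : (((k + m).choose k : ℕ) : ℝ) * (k.factorial * m.factorial) =
      ((k + m).factorial : ℝ) := by
    rw [← mul_assoc]
    have := Nat.choose_mul_factorial_mul_factorial (Nat.le_add_right k m)
    rw [add_tsub_cancel_left] at this
    exact_mod_cast this
  have hlog := congrArg Real.log hfac
  rw [Real.log_mul hchoose.ne' (by positivity), Real.log_mul (by positivity) (by positivity)]
    at hlog
  rw [Real.log_mul hchoose.ne' (by positivity), Real.log_mul (by positivity) (by positivity),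
    Real.log_pow, Real.log_pow]
  -- The upper bounds for k! and m! each lose at most log n + 1, which accounts for the error 2 log
  -- n + 2.
  have f1 := le_log_factorial hn
  have f2 := log_factorial_le hk
  have f3 := log_factorial_le hm
  have g1 : Real.log k ≤ Real.log ((k + m : ℕ) : ℝ) :=
    Real.log_le_log hk' (by push_cast; linarith)
  have g2 : Real.log m ≤ Real.log ((k + m : ℕ) : ℝ) :=
    Real.log_le_log hm' (by push_cast; linarith)
  have e0 : 1 - (k : ℝ) / ((k + m : ℕ) : ℝ) = m / ((k + m : ℕ) : ℝ) := by
    rw [eq_div_iff hn'.ne', sub_mul, div_mul_cancel₀ _ hn'.ne']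
    push_cast
    ring
  have e1 : ((k + m : ℕ) : ℝ) * (-binKL (k / ((k + m : ℕ) : ℝ)) s -
      (2 * Real.log ((k + m : ℕ) : ℝ) + 2) / ((k + m : ℕ) : ℝ)) =
      -(k * (Real.log k - Real.log ((k + m : ℕ) : ℝ) - Real.log s) +
        m * (Real.log m - Real.log ((k + m : ℕ) : ℝ) - Real.log (1 - s))) -
        (2 * Real.log ((k + m : ℕ) : ℝ) + 2) := by
    rw [binKL, e0, Real.log_div (div_pos hk' hn').ne' hs0.ne',
      Real.log_div (div_pos hm' hn').ne' h1s.ne', Real.log_div hk'.ne' hn'.ne',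
      Real.log_div hm'.ne' hn'.ne']
    field_simp
  rw [e1]
  have e2 : ((k + m : ℕ) : ℝ) = k + m := by push_cast; rfl
  rw [e2] at f1 g1 g2 ⊢
  nlinarith

/-- The event splits according to the set of positions where `p` holds; all sets of size k have the
same probability. -/
theorem exp_neg_binKL_le_pi_real {Ω : Type*} [Finite Ω] [MeasurableSpace Ω]
    [MeasurableSingletonClass Ω] (P : Measure Ω) [IsProbabilityMeasure P] {n k : ℕ}
    (p : Ω → Prop) [DecidablePred p] (hk : 0 < k) (hkn : k < n)
    (hs0 : 0 < P.real {x | p x}) (hs : P.real {x | p x} < 1) :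
    Real.exp (n * (-binKL (k / n) (P.real {x | p x}) - (2 * Real.log n + 2) / n)) ≤
      (Measure.pi fun _ : Fin n => P).real
        {xs | (Finset.univ.filter fun l => p (xs l)).card = k} := by
  refine (exp_neg_binKL_le_binomial hk hkn hs0 hs).trans (le_of_eq ?_)
  have h1 := sum_measureReal_preimage_singleton (μ := Measure.pi fun _ : Fin n => P)
    (f := fun xs : Fin n → Ω => Finset.univ.filter fun l => p (xs l))
    (Finset.powersetCard k (Finset.univ : Finset (Fin n)))
    (fun y _ => (Set.toFinite _).measurableSet)
  have h2 : {xs : Fin n → Ω | (Finset.univ.filter fun l => p (xs l)).card = k} =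
      (fun xs : Fin n → Ω => Finset.univ.filter fun l => p (xs l)) ⁻¹'
        ↑(Finset.powersetCard k (Finset.univ : Finset (Fin n))) := by
    ext xs
    simp [Finset.mem_powersetCard]
  have hcompl : P.real {x | ¬ p x} = 1 - P.real {x | p x} := by
    rw [← probReal_compl_eq_one_sub (Set.toFinite _).measurableSet]
    rfl
  have h3 : ∀ S ∈ Finset.powersetCard k (Finset.univ : Finset (Fin n)),
      (Measure.pi fun _ : Fin n => P).real
        ((fun xs : Fin n → Ω => Finset.univ.filter fun l => p (xs l)) ⁻¹' {S}) =
      P.real {x | p x} ^ k * (1 - P.real {x | p x}) ^ (n - k) := by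
    intro S hS
    rw [Finset.mem_powersetCard] at hS
    have h4 : (fun xs : Fin n → Ω => Finset.univ.filter fun l => p (xs l)) ⁻¹' {S} =
        Set.univ.pi fun l => if l ∈ S then {x | p x} else {x | ¬ p x} := by
      ext xs
      simp only [Set.mem_preimage, Set.mem_singleton_iff, Finset.ext_iff, Finset.mem_filter,
        Finset.mem_univ, true_and, Set.mem_univ_pi]
      refine forall_congr' fun l => ?_
      by_cases hl : l ∈ S <;> simp [hl]
    rw [h4, measureReal_def, Measure.pi_pi, ENNReal.toReal_prod]
    have h5 : ∀ l, (P (if l ∈ S then {x | p x} else {x | ¬ p x})).toReal =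
        if l ∈ S then P.real {x | p x} else 1 - P.real {x | p x} := by
      intro l
      split_ifs
      exacts [rfl, hcompl]
    simp only [h5]
    rw [Finset.prod_ite, Finset.prod_const, Finset.prod_const]
    congr 2
    · simp [hS.2]
    · rw [Finset.filter_not, Finset.card_sdiff_of_subset (Finset.filter_subset _ _)]
      simp [hS.2]
  rw [h2, ← h1, Finset.sum_congr rfl h3, Finset.sum_const, Finset.card_powersetCard, nsmul_eq_mul]
  simp

/-! ### The two error exponents -/

theorem le_normalizedLogProb {P : Measure (Fin d → Fin r)} [IsProbabilityMeasure P] {n : ℕ}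
    (hn : 0 < n) {A : Set (Fin n → Fin d → Fin r)} {c : ℝ}
    (h : Real.exp (n * c) ≤ (Measure.pi fun _ : Fin n => P).real A) :
    (c : EReal) ≤ normalizedLogProb P n A := by
  have hn' : (0 : EReal) < (n : EReal) := by exact_mod_cast hn
  rw [normalizedLogProb, EReal.le_div_iff_mul_le hn' (EReal.natCast_ne_top n),
    ← ofReal_measureReal (measure_ne_top _ A)]
  calc (c : EReal) * n = ((n * c : ℝ) : EReal) := by
        rw [mul_comm, EReal.coe_mul]; rfl
    _ = ENNReal.log (ENNReal.ofReal (Real.exp (n * c))) := by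
        rw [ENNReal.log_ofReal_of_pos (Real.exp_pos _), Real.log_exp]
    _ ≤ _ := ENNReal.log_le_log (ENNReal.ofReal_le_ofReal h)

theorem normalizedLogProb_le {P : Measure (Fin d → Fin r)} [IsProbabilityMeasure P] {n : ℕ}
    (hn : 0 < n) {A : Set (Fin n → Fin d → Fin r)} {c : ℝ}
    (h : (Measure.pi fun _ : Fin n => P).real A ≤ Real.exp (n * c)) :
    normalizedLogProb P n A ≤ (c : EReal) := by
  have hn' : (0 : EReal) < (n : EReal) := by exact_mod_cast hn
  rw [normalizedLogProb, EReal.div_le_iff_le_mul hn' (EReal.natCast_ne_top n),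
    ← ofReal_measureReal (measure_ne_top _ A)]
  calc _ ≤ ENNReal.log (ENNReal.ofReal (Real.exp (n * c))) :=
        ENNReal.log_le_log (ENNReal.ofReal_le_ofReal h)
    _ = ((n * c : ℝ) : EReal) := by
        rw [ENNReal.log_ofReal_of_pos (Real.exp_pos _), Real.log_exp]
    _ = (n : EReal) * c := by rw [EReal.coe_mul]; rfl

theorem tendsto_log_natCast_div :
    Tendsto (fun n : ℕ => Real.log n / n) atTop (𝓝 0) :=
  (Real.isLittleO_log_id_atTop.tendsto_div_nhds_zero).comp tendsto_natCast_atTop_atTop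

theorem exists_nodeMarginal_le_half (hr : 2 ≤ r) (P : Measure (Fin d → Fin r))
    [IsProbabilityMeasure P] (i : Fin d) : ∃ a, nodeMarginal P i a ≤ 1 / 2 := by
  by_contra! h
  have hne : (⟨0, by omega⟩ : Fin r) ≠ ⟨1, by omega⟩ := by simp
  have h1 := Finset.sum_le_sum_of_subset_of_nonneg
    (Finset.subset_univ ({⟨0, by omega⟩, ⟨1, by omega⟩} : Finset (Fin r)))
    (fun a _ _ => nodeMarginal_nonneg P i a)
  rw [Finset.sum_pair hne, sum_nodeMarginal] at h1
  have h2 := h ⟨0, by omega⟩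
  have h3 := h ⟨1, by omega⟩
  linarith

theorem neg_le_liminf_normalizedLogProb (hd : 2 ≤ d) (hr : 2 ≤ r)
    {P Ptilde : Measure (Fin d → Fin r)} [IsProbabilityMeasure P]
    (hP : ∀ i j : Fin d, i ≠ j → ∀ a b : Fin r, 0 < pairMarginal P i j a b)
    (hPt : IsForestProjection P Ptilde)
    {Fhat : (n : ℕ) → (Fin n → Fin d → Fin r) → SimpleGraph (Fin d)}
    (hF : ∀ (n : ℕ) (xs : Fin n → Fin d → Fin r), 1 ≤ n → (Fhat n xs).IsAcyclic)
    {δ : ℝ} (hδ : 0 < δ) :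
    ((-(δ * d) : ℝ) : EReal) ≤
      liminf (fun n : ℕ => normalizedLogProb P n (riskEvent P Ptilde n (Fhat n) δ)) atTop := by
  have hr0 : 0 < r := by omega
  have hd0 : (0 : ℝ) < d := by positivity
  obtain ⟨a, ha⟩ := exists_nodeMarginal_le_half hr P ⟨0, by omega⟩
  set i : Fin d := ⟨0, by omega⟩ with hi
  have hs0 := nodeMarginal_pos_of_pairMarginal_pos hd hr0 P hP i a
  have hs1 : nodeMarginal P i a < 1 := by linarith
  refine EReal.ge_of_forall_gt_iff_ge.mp fun z hz => ?_
  rw [EReal.coe_lt_coe_iff] at hz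
  have hδd : 0 < δ * d := mul_pos hδ hd0
  -- Since -z > δd, a frequency at or below `t` forces the risk strictly above δd, while the
  -- frequency tends to `t` with exponent at most -z.
  obtain ⟨t, ht0, hts, htz⟩ := exists_binKL_eq hs0 hs1 (by linarith : 0 < -z)
  have ht1 : t < 1 := hts.trans hs1
  have hk : Tendsto (fun n : ℕ => ((⌊t * n⌋₊ : ℕ) : ℝ) / n) atTop (𝓝 t) :=
    (tendsto_nat_floor_mul_div_atTop ht0.le).comp tendsto_natCast_atTop_atTop
  have hcont : ContinuousAt (fun u => binKL u (nodeMarginal P i a)) t :=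
    (continuousOn_binKL_left hs0 hs1).continuousAt (Ioo_mem_nhds ht0 ht1)
  have hlim : Tendsto (fun n : ℕ => -binKL (((⌊t * n⌋₊ : ℕ) : ℝ) / n) (nodeMarginal P i a) -
      (2 * Real.log n + 2) / n) atTop (𝓝 (-binKL t (nodeMarginal P i a))) := by
    have h1 := (hcont.tendsto.comp hk).neg
    have h2 : Tendsto (fun n : ℕ => (2 * Real.log n + 2) / n) atTop (𝓝 0) := by
      have h3 := (tendsto_log_natCast_div.const_mul 2).add (tendsto_const_div_atTop_nhds_zero_nat 2)
      simp only [mul_zero, add_zero] at h3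
      exact h3.congr fun n => by ring
    simpa using h1.sub h2
  have hlim' := ((continuous_coe_real_ereal.tendsto _).comp hlim).liminf_eq
  have hkl := binKL_le_binKL_swap ht0 hts ha
  calc (z : EReal) ≤ ((-binKL t (nodeMarginal P i a) : ℝ) : EReal) := by
        rw [EReal.coe_le_coe_iff]; linarith
    _ = _ := hlim'.symm
    _ ≤ _ := liminf_le_liminf ?_
  have hpos : ∀ᶠ n : ℕ in atTop, 0 < ((⌊t * n⌋₊ : ℕ) : ℝ) / n := hk.eventually_const_lt ht0
  have hlt : ∀ᶠ n : ℕ in atTop, ((⌊t * n⌋₊ : ℕ) : ℝ) / n < 1 := hk.eventually_lt_const ht1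
  filter_upwards [hpos, hlt, eventually_gt_atTop 0] with n hn1 hn2 hn0
  have hn' : (0 : ℝ) < n := by exact_mod_cast hn0
  have hk0 : 0 < ⌊t * n⌋₊ := by
    rw [Nat.pos_iff_ne_zero]
    intro h
    simp [h] at hn1
  have hkn : ⌊t * n⌋₊ < n := by
    rw [div_lt_one hn'] at hn2
    exact_mod_cast hn2
  have := isProbabilityMeasure_empirical (d := d) (r := r) hn0
  refine le_normalizedLogProb hn0 ((exp_neg_binKL_le_pi_real P (fun x => x i = a) hk0 hkn
    hs0 hs1).trans (measureReal_mono fun xs hxs => ?_))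
  have hfreq : nodeMarginal (empirical xs) i a = ((⌊t * n⌋₊ : ℕ) : ℝ) / n := by
    rw [nodeMarginal_empirical, wordType]
    congr 2
  -- Rounding down keeps the frequency on the side of `t` where the binary divergence is larger.
  have hle : nodeMarginal (empirical xs) i a ≤ t := by
    rw [hfreq, div_le_iff₀ hn']
    exact Nat.floor_le (by positivity)
  have hrisk := binKL_le_risk hd hr0 hP hPt (hF n xs hn0) hle hts.le hs1
  have hdE : (0 : EReal) < (d : EReal) := by exact_mod_cast (by omega : 0 < d)
  refine (EReal.lt_div_iff hdE (EReal.natCast_ne_top d)).mpr (lt_of_lt_of_le ?_ hrisk)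
  have hcast : (δ : EReal) * (d : EReal) = ((δ * d : ℝ) : EReal) := by
    rw [EReal.coe_mul]; rfl
  rw [hcast, EReal.coe_lt_coe_iff]
  linarith

theorem limsup_normalizedLogProb_le (hd : 2 ≤ d) (hr : 2 ≤ r)
    {P Ptilde : Measure (Fin d → Fin r)} [IsProbabilityMeasure P]
    (hP : ∀ i j : Fin d, i ≠ j → ∀ a b : Fin r, 0 < pairMarginal P i j a b)
    (hPt : IsForestStructured Ptilde) :
    ∃ δ₀ : ℝ, 0 < δ₀ ∧ ∀ ε : ℕ → ℝ, Tendsto ε atTop (𝓝 0) →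
      ∀ Fhat : (n : ℕ) → (Fin n → Fin d → Fin r) → SimpleGraph (Fin d),
        (∀ (n : ℕ) (xs : Fin n → Fin d → Fin r), 1 ≤ n →
          IsOutput (ε n) (empirical xs) (Fhat n xs)) →
      ∀ δ : ℝ, δ < δ₀ → limsup (fun n : ℕ =>
        normalizedLogProb P n (riskEvent P Ptilde n (Fhat n) δ)) atTop ≤ ((-δ : ℝ) : EReal) := by
  have hr0 : 0 < r := by omega
  have hd0 : 0 < d := by omega
  obtain ⟨δ₀, hδ₀, ε₀, hε₀, hbound⟩ := exists_risk_bound hd hr0 hP hPt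
  refine ⟨δ₀, hδ₀, fun ε hε Fhat hF δ hδ => ?_⟩
  -- The prefactors are 2d², bounding the d² + d events of the union bound, and (n+1)^(r²), bounding
  -- the number of types on pairs; neither affects the exponent.
  have hlim : Tendsto (fun n : ℕ => (Real.log (2 * (d : ℝ) ^ 2) +
      (r * r : ℕ) * Real.log ((n : ℝ) + 1)) / n + -δ) atTop (𝓝 (-δ)) := by
    have h1 : Tendsto (fun n : ℕ => Real.log ((n : ℝ) + 1) / n) atTop (𝓝 0) := by
      have h2 := (tendsto_log_natCast_div.comp (tendsto_add_atTop_nat 1)).mul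
        ((tendsto_const_div_atTop_nhds_zero_nat 1).const_add 1)
      simp only [zero_mul] at h2
      refine h2.congr' ?_
      filter_upwards [eventually_gt_atTop 0] with n hn
      have : (n : ℝ) ≠ 0 := by positivity
      simp only [Function.comp_apply]
      push_cast
      field_simp
    have h3 := ((tendsto_const_div_atTop_nhds_zero_nat (Real.log (2 * (d : ℝ) ^ 2))).add
      (h1.const_mul ((r * r : ℕ) : ℝ))).add_const (-δ)
    simp only [mul_zero, add_zero, zero_add] at h3
    exact h3.congr fun n => by ring
  rw [← ((continuous_coe_real_ereal.tendsto _).comp hlim).limsup_eq]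
  refine limsup_le_limsup ?_
  filter_upwards [hε.eventually_lt_const hε₀, eventually_gt_atTop 0] with n hεn hn
  have hn' : (0 : ℝ) < n := by exact_mod_cast hn
  have hemp := isProbabilityMeasure_empirical (d := d) (r := r) hn
  refine normalizedLogProb_le hn ?_
  set pairBad : Fin d → Fin d → Set (Fin n → Fin d → Fin r) := fun i j =>
    {xs | i ≠ j ∧ δ ≤ relEnt (pairLaw (empirical xs) i j) (pairLaw P i j)} with hpairBad
  set nodeBad : Fin d → Set (Fin n → Fin d → Fin r) := fun i =>
    {xs | δ ≤ relEnt (nodeMarginal (empirical xs) i) (nodeMarginal P i)} with hnodeBad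
  have hsub : riskEvent P Ptilde n (Fhat n) δ ⊆ (⋃ i, ⋃ j, pairBad i j) ∪ ⋃ i, nodeBad i := by
    intro xs hxs
    by_contra hcon
    simp only [Set.mem_union, Set.mem_iUnion, not_or, not_exists, hpairBad, hnodeBad,
      Set.mem_ofPred_eq, not_and, not_le] at hcon
    have hrisk := hbound (empirical xs) (Fhat n xs) (ε n) δ (hF n xs hn) hεn.le hδ.le
      (fun i j hij => (hcon.1 i j hij).le) (fun i => (hcon.2 i).le)
    refine absurd (show (δ : EReal) < _ from hxs) (not_lt.mpr ?_)
    have hdE : (0 : EReal) < (d : EReal) := by exact_mod_cast hd0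
    rw [EReal.div_le_iff_le_mul hdE (EReal.natCast_ne_top d)]
    refine hrisk.trans (le_of_eq ?_)
    rw [EReal.coe_mul]
    rfl
  set B : ℝ := ((n : ℝ) + 1) ^ (r * r) * Real.exp (-(n * δ)) with hB
  have hB0 : 0 ≤ B := by positivity
  have hpair : ∀ i j, (Measure.pi fun _ : Fin n => P).real (pairBad i j) ≤ B := by
    intro i j
    by_cases hij : i = j
    · have : pairBad i j = ∅ := by
        ext xs
        simp [hpairBad, hij]
      rw [this, measureReal_empty]
      exact hB0
    · have h := pi_real_relEnt_ge_le P hn (fun x => (x i, x j))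
        (fun p => by
          have := hP i j hij p.1 p.2
          simpa only [pairMarginal, Prod.ext_iff] using this) δ
      rw [Fintype.card_prod, Fintype.card_fin, ← pairLaw_eq] at h
      refine (measureReal_mono fun xs hxs => ?_).trans h
      have := hxs.2
      rwa [pairLaw_empirical] at this
  have hnode : ∀ i, (Measure.pi fun _ : Fin n => P).real (nodeBad i) ≤ B := by
    intro i
    have h := pi_real_relEnt_ge_le P hn (fun x => x i)
      (fun a => nodeMarginal_pos_of_pairMarginal_pos hd hr0 P hP i a) δ
    rw [Fintype.card_fin] at h
    refine le_trans ((measureReal_mono fun xs hxs => ?_).trans h) ?_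
    · have : δ ≤ relEnt (nodeMarginal (empirical xs) i) (nodeMarginal P i) := hxs
      rwa [nodeMarginal_empirical] at this
    · refine mul_le_mul_of_nonneg_right ?_ (Real.exp_pos _).le
      exact pow_le_pow_right₀ (by linarith) (Nat.le_mul_self r)
  calc (Measure.pi fun _ : Fin n => P).real (riskEvent P Ptilde n (Fhat n) δ)
      ≤ ∑ i : Fin d, ∑ j : Fin d, B + ∑ i : Fin d, B := by
        refine (measureReal_mono hsub).trans ((measureReal_union_le _ _).trans (add_le_add ?_ ?_))
        · exact (measureReal_iUnion_fintype_le _).trans (Finset.sum_le_sum fun i _ =>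
            (measureReal_iUnion_fintype_le _).trans (Finset.sum_le_sum fun j _ => hpair i j))
        · exact (measureReal_iUnion_fintype_le _).trans (Finset.sum_le_sum fun i _ => hnode i)
    _ ≤ 2 * (d : ℝ) ^ 2 * B := by
        simp only [Finset.sum_const, Finset.card_univ, Fintype.card_fin, nsmul_eq_mul]
        have h1 : (1 : ℝ) ≤ d := by exact_mod_cast hd0
        nlinarith [mul_le_mul_of_nonneg_right h1 (mul_nonneg (by linarith : (0 : ℝ) ≤ d) hB0)]
    _ = _ := by
        have hd' : (0 : ℝ) < 2 * (d : ℝ) ^ 2 := by positivity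
        rw [mul_add, mul_div_cancel₀ _ hn'.ne', Real.exp_add, Real.exp_add, Real.exp_log hd',
          ← Real.log_pow, Real.exp_log (by positivity), hB, mul_neg]
        ring

end CLThres

end

theorem mainTheorem4 {d r : ℕ} (hd : 2 ≤ d) (hr : 2 ≤ r)
    (P : Measure (Fin d → Fin r)) [IsProbabilityMeasure P]
    (hP : ∀ i j : Fin d, i ≠ j → ∀ a b : Fin r, 0 < CLThres.pairMarginal P i j a b)
    (Ptilde : Measure (Fin d → Fin r)) (hPtilde : CLThres.IsForestProjection P Ptilde) :
    ∃ δ₀ : ℝ, 0 < δ₀ ∧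
      ∀ ε : ℕ → ℝ, Tendsto ε atTop (nhds 0) →
      ∀ Fhat : (n : ℕ) → (Fin n → Fin d → Fin r) → SimpleGraph (Fin d),
        (∀ (n : ℕ) (xs : Fin n → Fin d → Fin r), 1 ≤ n →
          CLThres.IsOutput (ε n) (CLThres.empirical xs) (Fhat n xs)) →
      ∀ δ : ℝ, 0 < δ → δ < δ₀ →
        limsup (fun n : ℕ => CLThres.normalizedLogProb P n
          (CLThres.riskEvent P Ptilde n (Fhat n) δ)) atTop ≤ ((-δ : ℝ) : EReal) ∧
        ((-(δ * d) : ℝ) : EReal) ≤ liminf (fun n : ℕ => CLThres.normalizedLogProb P n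
          (CLThres.riskEvent P Ptilde n (Fhat n) δ)) atTop := by
  obtain ⟨δ₀, hδ₀, hupper⟩ := CLThres.limsup_normalizedLogProb_le hd hr hP hPtilde.1
  exact ⟨δ₀, hδ₀, fun ε hε Fhat hF δ hδ hδ' => ⟨hupper ε hε Fhat hF δ hδ',
    CLThres.neg_le_liminf_normalizedLogProb hd hr hP hPtilde
      (fun n xs hn => (hF n xs hn).isAcyclic) hδ⟩⟩
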